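/- Let $G=(V,E)$ be a finite undirected network on linearly ordered processes, let $T\subseteq V$ be the set of trusted processes, and let $f\ge 0$. A set $B\subseteq V\setminus T$ with $|B|\le f$ of processes is Byzantine; the others are correct. Channels are the edges of $G$; they are authenticated, reliable (a packet in transit to a correct process is eventually received, exactly once) and asynchronous. Byzantine processes may send arbitrary packets on their own channels, but cannot produce a signature $\sigma_s(m)$ of a correct process $s$ that never signed $m$. Payloads range over a nonempty set. In SigFlood-T, a correct $s$ broadcasts a payload $m$ (each payload at most once) by sending $[m,\sigma_s(m)]$ to all its neighbors and delivering $m$. A correct $q$ that receives $[m,\sigma_s(m)]$ from a neighbor $p$ does nothing if it has already delivered the message $m$ of $s$; otherwise, if $p\in T$ or the signature is valid, it delivers the message and forwards the packet to all its neighbors except $p$ and $s$. For $u\ne v$ let $H_{u,v}$ be the graph with vertex set $(V\setminus T)\cup\{u,v\}$ in which two distinct vertices are adjacent if they are neighbors in $G$ or are joined in $G$ by a path all of whose inner vertices are trusted; if $u$ and $v$ are both untrusted this is $f(G)$, and trusted endpoints are inserted by the operation $g$. Let $\kappa_H(u,v)$ be the maximum number of internally vertex-disjoint $u$–$v$ paths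 in $H$. For an integer $k$ and $u\in V$, let $D_{k,u}$ be the digraph in which every $x\in V$ is split into $x_{\rm in},x_{\rm out}$, with an arc $(x_{\rm in},x_{\rm out})$ of capacity $k$ if $x\in T$ and $1$ otherwise, and, for all neighbors $x,y$ in $G$, an arc $(x_{\rm out},y_{\rm in})$ of capacity $k$ if $x\in T$ or $x=u$, and $1$ otherwise. Then for all $G,T,f$: 1. (RC-No duplication) In every execution a correct process delivers each message of each broadcaster at most once. 2. (RC-No creation) In every execution, if a correct process delivers a message $m$ of a correct broadcaster $s$, then $s$ has broadcast $m$. 3. (RC-Validity) The property "for every admissible $B$ and every execution, if a correct process broadcasts a message, then every correct process eventually delivers it" holds if and only if for all $u<v$, $u$ and $v$ are adjacent in $H_{u,v}$ or $\kappa_{H_{u,v}}(u,v)\ge f+1$. It also holds if and only if for all $u<v$, $u$ and $v$ are adjacent in $H_{u,v}$ or the maximum flow from $u_{\rm out}$ to $v_{\rm in}$ in $D_{f+1,u}$ is at least $f+1$. 4. If $T=\emptyset$, RC-Validity holds if and only if $G$ is complete or $(f+1)$-vertex-connected (that is, $|V|>f+1$ and deleting any at most $f$ vertices leaves a connected graph).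 In particular, if $T=\emptyset$ and $|V|\ge f+2$, it holds if and only if $G$ is $(f+1)$-vertex-connected. -/

import Mathlib

namespace SigFloodT

/-! ## Graphs: contraction of trusted nodes, connectivity, verification conditions -/

section Graphs

variable {V : Type*}

/-- `u` and `v` are joined by a nonempty sequence of trusted nodes `p 0, …, p n` of `G`:
`u — p 0 — ⋯ — p n — v`. -/
def TrustedPath (G : SimpleGraph V) (T : Finset V) (u v : V) : Prop :=
  ∃ (n : ℕ) (p : ℕ → V), (∀ i ≤ n, p i ∈ T) ∧ G.Adj u (p 0) ∧ G.Adj (p n) v ∧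
    ∀ i < n, G.Adj (p i) (p (i + 1))

theorem TrustedPath.symm {G : SimpleGraph V} {T : Finset V} {u v : V}
    (h : TrustedPath G T u v) : TrustedPath G T v u := by
  obtain ⟨n, p, hT, h0, hn, hs⟩ := h
  refine ⟨n, fun i => p (n - i), fun i _ => hT _ (Nat.sub_le _ _), ?_, ?_, ?_⟩
  · simpa using hn.symm
  · simpa using h0.symm
  · intro i hi
    have h1 := (hs (n - (i + 1)) (by omega)).symm
    have h2 : n - (i + 1) + 1 = n - i := by omega
    rwa [h2] at h1

/-- Neighbours in `G`, or joined by a path of trusted nodes of `G`. -/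
def Linked (G : SimpleGraph V) (T : Finset V) (u v : V) : Prop :=
  G.Adj u v ∨ TrustedPath G T u v

theorem Linked.symm {G : SimpleGraph V} {T : Finset V} {u v : V}
    (h : Linked G T u v) : Linked G T v u :=
  h.elim (fun h => Or.inl h.symm) (fun h => Or.inr h.symm)

/-- A simple graph whose vertex set is a subset of `V`. -/
abbrev GraphOn (V : Type*) := (⊤ : SimpleGraph V).Subgraph

/-- The graph `f(G)`: its vertices are the untrusted nodes, and two distinct untrusted nodes are
adjacent iff they are neighbours in `G` or joined by a path of trusted nodes of `G`. -/
def untrustedGraph (G : SimpleGraph V) (T : Finset V) : GraphOn V where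
  verts := {v | v ∉ T}
  Adj u v := u ∉ T ∧ v ∉ T ∧ u ≠ v ∧ Linked G T u v
  adj_sub h := h.2.2.1
  edge_vert h := h.1
  symm := ⟨fun _ _ h => ⟨h.2.1, h.1, h.2.2.1.symm, h.2.2.2.symm⟩⟩

/-- The graph `g(G, H, w)`: the node `w` is added to `H`, and joined to those vertices of `H` that
are its neighbours in `G` or are joined to it by a path of trusted nodes of `G`. -/
def addNode (G : SimpleGraph V) (T : Finset V) (H : GraphOn V) (w : V) : GraphOn V where
  verts := insert w H.verts
  Adj u v := H.Adj u v ∨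
    (v = w ∧ u ∈ H.verts ∧ u ≠ w ∧ Linked G T u w) ∨
    (u = w ∧ v ∈ H.verts ∧ v ≠ w ∧ Linked G T v w)
  adj_sub := by
    rintro u v (h | ⟨rfl, -, h, -⟩ | ⟨rfl, -, h, -⟩)
    · exact H.adj_sub h
    · exact h
    · exact h.symm
  edge_vert := by
    rintro u v (h | ⟨-, h, -, -⟩ | ⟨rfl, -, -, -⟩)
    · exact Set.mem_insert_of_mem _ (H.edge_vert h)
    · exact Set.mem_insert_of_mem _ h
    · exact Set.mem_insert _ _
  symm := by
    refine ⟨?_⟩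
    rintro u v (h | h | h)
    · exact Or.inl h.symm
    · exact Or.inr (Or.inr h)
    · exact Or.inr (Or.inl h)

/-- A finite set of `u`–`v` paths, any two of which share no vertex except `u` and `v`. -/
def InternallyDisjoint {G : SimpleGraph V} {u v : V} (P : Finset (G.Path u v)) : Prop :=
  ∀ p ∈ P, ∀ q ∈ P, p ≠ q → ∀ w, w ∈ p.1.support → w ∈ q.1.support → w = u ∨ w = v

/-- `κ_G(u, v)`: the largest number of internally vertex-disjoint `u`–`v` paths. -/
noncomputable def kappa (G : SimpleGraph V) (u v : V) : ℕ∞ :=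
  ⨆ P : {P : Finset (G.Path u v) // InternallyDisjoint P}, (P.1.card : ℕ∞)

/-- Standard `k`-vertex-connectivity: more than `k` vertices, and deleting any set of fewer than
`k` vertices leaves a connected graph. -/
def VertexConnected [Fintype V] (G : SimpleGraph V) (k : ℕ) : Prop :=
  k < Fintype.card V ∧ ∀ S : Finset V, S.card < k → (G.induce {v | v ∉ S}).Connected

/-- The connectivity-based verification (with threshold `k`): any two distinct nodes are
adjacent or `k`-connected to each other in the graph obtained from `f(G)` by inserting those of the
two nodes that are trusted. -/
def ConnectivityVerif [LinearOrder V] (G : SimpleGraph V) (T : Finset V) (k : ℕ) : Prop :=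
  (∀ u v : V, u ∉ T → v ∉ T → u < v →
    (k : ℕ∞) ≤ kappa (untrustedGraph G T).spanningCoe u v ∨ (untrustedGraph G T).Adj v u) ∧
  (∀ u v : V, u ∈ T → v ∉ T →
    (k : ℕ∞) ≤ kappa (addNode G T (untrustedGraph G T) u).spanningCoe u v ∨
      (addNode G T (untrustedGraph G T) u).Adj v u) ∧
  (∀ u v : V, u ∈ T → v ∈ T → u < v →
    (k : ℕ∞) ≤ kappa (addNode G T (addNode G T (untrustedGraph G T) u) v).spanningCoe u v ∨
      (addNode G T (addNode G T (untrustedGraph G T) u) v).Adj v u)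

/-- A flow from `s` to `t` in the network with capacities `c`. -/
structure IsFlow {W : Type*} [Fintype W] (c : W → W → ℕ) (s t : W) (φ : W → W → ℝ) : Prop where
  nonneg : ∀ x y, 0 ≤ φ x y
  le_cap : ∀ x y, φ x y ≤ c x y
  conserve : ∀ x, x ≠ s → x ≠ t → ∑ y, φ x y = ∑ y, φ y x

/-- The maximum of the net flow out of `s` over all flows from `s` to `t`. -/
noncomputable def maxFlow {W : Type*} [Fintype W] (c : W → W → ℕ) (s t : W) : ℝ :=
  sSup {r | ∃ φ, IsFlow c s t φ ∧ r = ∑ y, φ s y - ∑ y, φ y s}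

open Classical in
/-- Capacities of the split digraph used for flows out of `u`. The node `x` is split into
`(x, false)` (in) and `(x, true)` (out). The arc from in to out has capacity `k` if `x` is trusted
and `1` otherwise; an arc from the out copy of `x` to the in copy of a neighbour has capacity `k` if
`x` is trusted or `x = u`, and `1` otherwise. All other pairs are not arcs. -/
noncomputable def splitCap (G : SimpleGraph V) (T : Finset V) (k : ℕ) (u : V) :
    V × Bool → V × Bool → ℕ
  | (x, false), (y, true) => if x = y then (if x ∈ T then k else 1) else 0
  | (x, true), (y, false) => if G.Adj x y then (if x ∈ T ∨ x = u then k else 1) else 0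
  | (_, false), (_, false) => 0
  | (_, true), (_, true) => 0

/-- The flow-based verification (with threshold `k`): any two nodes `u < v` are adjacent in the
graph obtained from `f(G)` by inserting those of them that are trusted, or the maximum flow from
the out copy of `u` to the in copy of `v` is at least `k`. -/
def MaxFlowVerif [Fintype V] [LinearOrder V] (G : SimpleGraph V) (T : Finset V) (k : ℕ) : Prop :=
  ∀ u v : V, u < v →
    ((u ∉ T ∧ v ∉ T ∧ (untrustedGraph G T).Adj u v) ∨
     (u ∈ T ∧ v ∉ T ∧ (addNode G T (untrustedGraph G T) u).Adj u v) ∨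
     (u ∉ T ∧ v ∈ T ∧ (addNode G T (untrustedGraph G T) v).Adj v u) ∨
     (u ∈ T ∧ v ∈ T ∧ (addNode G T (addNode G T (untrustedGraph G T) u) v).Adj v u)) ∨
    (k : ℝ) ≤ maxFlow (splitCap G T k u) (u, true) (v, false)

end Graphs

/-! ## The protocol and its executions -/

/-- An ideal signature: it determines the process that made it and the signed payload. -/
structure Signature (V M : Type*) where
  signer : V
  content : M

/-- A protocol message: payload, claimed broadcaster, signature. -/
structure Packet (V M : Type*) where
  payload : M
  sender : V
  sig : Signature V M

/-- Verification: the signature is the claimed broadcaster's signature on the payload. -/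
def Packet.Verif {V M : Type*} (k : Packet V M) : Prop :=
  k.sig.signer = k.sender ∧ k.sig.content = k.payload

/-- The packet `[m, σ_p(m)]` sent by a broadcaster `p`. -/
def signedPacket {V M : Type*} (p : V) (m : M) : Packet V M := ⟨m, p, ⟨p, m⟩⟩

/-- A global state: which correct processes have broadcast (hence signed) which payloads; the
`delivered` flags, where `(q, s, m)` means that `q` has delivered the message `m` of `s`; and the
packets in transit, where `(p, q, k)` is a copy of `k` travelling from `p` to `q`. -/
structure State (V M : Type*) where
  signed : Set (V × M)
  delivered : Set (V × V × M)
  transit : Multiset (V × V × Packet V M)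

/-- No broadcast, no delivery, empty channels. -/
def State.init (V M : Type*) : State V M := ⟨∅, ∅, 0⟩

inductive Event (V M : Type*)
  /-- nothing happens -/
  | idle
  /-- the correct process `p` broadcasts `m` -/
  | broadcast (p : V) (m : M)
  /-- `q` receives `k` from its neighbour `p` -/
  | receive (p q : V) (k : Packet V M)
  /-- the faulty process `b` sends `k` to its neighbour `q` -/
  | inject (b q : V) (k : Packet V M)

section Protocol

variable {V M : Type*} [Fintype V]

open Classical in
/-- One copy of `k` from `p` to each neighbour of `p` outside `excl`. -/
noncomputable def sendAll (G : SimpleGraph V) (p : V) (excl : Set V) (k : Packet V M) :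
    Multiset (V × V × Packet V M) :=
  (Finset.univ.filter fun q => G.Adj p q ∧ q ∉ excl).val.map fun q => (p, q, k)

/-- The test a correct process `q` applies to a packet `k` received from `p`: it has not yet
delivered the message, and `p` is trusted or the signature is valid. -/
def Accepts (T : Finset V) (st : State V M) (p q : V) (k : Packet V M) : Prop :=
  (q, k.sender, k.payload) ∉ st.delivered ∧ (p ∈ T ∨ k.Verif)

/-- `Step G T B st e o st'`: with faulty set `B`, the event `e` leads from `st` to `st'`; the output
`o` is `some (q, s, m)` if `q` delivers the message `m` of broadcaster `s` in this step. -/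
inductive Step (G : SimpleGraph V) (T B : Finset V) :
    State V M → Event V M → Option (V × V × M) → State V M → Prop
  | idle (st : State V M) : Step G T B st .idle none st
  | broadcast (st : State V M) (p : V) (m : M) (hp : p ∉ B) (hnew : (p, m) ∉ st.signed) :
      Step G T B st (.broadcast p m) (some (p, p, m))
        { signed := insert (p, m) st.signed
          delivered := insert (p, p, m) st.delivered
          transit := st.transit + sendAll G p ∅ (signedPacket p m) }
  /-- A correct process accepts a packet, delivers its message, and forwards the packet. -/
  | accept (st : State V M) (p q : V) (k : Packet V M) (rest : Multiset (V × V × Packet V M))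
      (hk : st.transit = (p, q, k) ::ₘ rest) (hq : q ∉ B) (hacc : Accepts T st p q k) :
      Step G T B st (.receive p q k) (some (q, k.sender, k.payload))
        { signed := st.signed
          delivered := insert (q, k.sender, k.payload) st.delivered
          transit := rest + sendAll G q {p, k.sender} k }
  /-- A packet reaches a faulty process, or a correct one that does not accept it. -/
  | discard (st : State V M) (p q : V) (k : Packet V M) (rest : Multiset (V × V × Packet V M))
      (hk : st.transit = (p, q, k) ::ₘ rest) (hq : q ∈ B ∨ ¬ Accepts T st p q k) :
      Step G T B st (.receive p q k) none { st with transit := rest }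
  /-- A faulty process sends an arbitrary packet over one of its channels. It cannot forge a
  signature of a correct process on a payload which that process never signed. -/
  | inject (st : State V M) (b q : V) (k : Packet V M) (hb : b ∈ B) (hadj : G.Adj b q)
      (hsig : k.sig.signer ∈ B ∨ (k.sig.signer, k.sig.content) ∈ st.signed) :
      Step G T B st (.inject b q k) none { st with transit := (b, q, k) ::ₘ st.transit }

/-- An infinite execution from the initial state (idle steps model finite ones). -/
structure Execution (M : Type*) (G : SimpleGraph V) (T B : Finset V) where
  state : ℕ → State V M
  event : ℕ → Event V M
  output : ℕ → Option (V × V × M)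
  init : state 0 = State.init V M
  step : ∀ t, Step G T B (state t) (event t) (output t) (state (t + 1))

/-- Reliable channels: a packet in transit to a correct process is eventually received. -/
def Execution.Fair {G : SimpleGraph V} {T B : Finset V} (ex : Execution M G T B) : Prop :=
  ∀ t p q k, q ∉ B → (p, q, k) ∈ (ex.state t).transit → ∃ t' ≥ t, ex.event t' = .receive p q k

/-- A possible set of faulty processes: at most `f` processes, none of them trusted. -/
def Faulty (T : Finset V) (f : ℕ) (B : Finset V) : Prop := Disjoint B T ∧ B.card ≤ f

/-- No correct process delivers the same message (of the same broadcaster) twice. -/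
def RCNoDuplication (M : Type*) (G : SimpleGraph V) (T : Finset V) (f : ℕ) : Prop :=
  ∀ B, Faulty T f B → ∀ ex : Execution M G T B, ∀ q ∉ B, ∀ (s : V) (m : M) (t t' : ℕ),
    ex.output t = some (q, s, m) → ex.output t' = some (q, s, m) → t = t'

/-- If a correct process delivers a message of a correct broadcaster `s`, then `s` broadcast it,
not later than the delivery. -/
def RCNoCreation (M : Type*) (G : SimpleGraph V) (T : Finset V) (f : ℕ) : Prop :=
  ∀ B, Faulty T f B → ∀ ex : Execution M G T B, ∀ q ∉ B, ∀ s ∉ B, ∀ (m : M) (t : ℕ),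
    ex.output t = some (q, s, m) → ∃ t' ≤ t, ex.event t' = .broadcast s m

/-- If a correct process broadcasts a message, every correct process eventually delivers it. -/
def RCValidity (M : Type*) (G : SimpleGraph V) (T : Finset V) (f : ℕ) : Prop :=
  ∀ B, Faulty T f B → ∀ ex : Execution M G T B, ex.Fair → ∀ s ∉ B, ∀ (m : M) (t : ℕ),
    ex.event t = .broadcast s m → ∀ q ∉ B, ∃ t', ex.output t' = some (q, s, m)

end Protocol

end SigFloodT

namespace SigFloodT

/-! Both directions of validity meet in one condition: deleting any admissible faulty set leaves
every two correct processes connected, expressed by `ReachIn`.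

Safety follows from `Invariant`, preserved by every step. Its main point is that trusting a relay is
harmless: a trusted process is correct, so it has only sent validly signed packets. If correct
processes stay connected, a message travels along a walk of correct processes, because a neighbor
left out of forwarding has already delivered it (`Step.forward`). Conversely, let the faulty
processes be silent and run the channels dry (`exists_silent_execution`). Deliveries then stay among
the processes reachable from the broadcaster through correct ones (`Step.confined`), so validity
forces reachability.

The rest is graph theory. Contracting trusted vertices preserves separation by faulty sets
(`forall_faulty_reachIn_iff`), since trusted vertices never fail. In the contracted graph Menger's
theorem turns separation into disjoint paths (`reachIn_iff_adj_or_le_kappa`). It is derived from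
Hall's theorem in `exists_linkage`: a matching of the vertices to their successors, followed
repeatedly, traces the paths.

For flows, only easy halves are needed. Disjoint paths of the contracted graph expand to paths of
`G` meeting only in trusted vertices and ends, hence to a flow of value `f + 1`. Conversely, a
separating faulty set gives a cut of capacity at most `f`. The circle closes through reachability,
without max-flow min-cut. -/

/-- `b` is reached from `a` by a walk of `G` all of whose vertices after `a` lie in `X`. -/
def ReachIn {V : Type*} (G : SimpleGraph V) (X : Set V) (a b : V) : Prop :=
  Relation.ReflTransGen (fun x y => G.Adj x y ∧ y ∈ X) a b

/-- The start of a walk is not required to lie in `X`, so reversal needs `ha` for the new last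
vertex. -/
theorem ReachIn.symm {V : Type*} {G : SimpleGraph V} {X : Set V} {a b : V} (ha : a ∈ X)
    (h : ReachIn G X a b) : ReachIn G X b a := by
  induction h with
  | refl => exact .refl
  | @tail c d hac hcd ih =>
    have hc : c ∈ X := by
      cases hac with
      | refl => exact ha
      | tail _ h => exact h.2
    exact Relation.ReflTransGen.head ⟨hcd.1.symm, hc⟩ ih

theorem ReachIn.mono {V : Type*} {G : SimpleGraph V} {X Y : Set V} {a b : V} (hXY : X ⊆ Y)
    (h : ReachIn G X a b) : ReachIn G Y a b :=
  Relation.ReflTransGen.mono (fun _ _ h => ⟨h.1, hXY h.2⟩) _ _ h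

/-! ### Safety invariants, and propagation along correct processes -/

section Safety

variable {V M : Type*} {G : SimpleGraph V} {T B : Finset V}

/-- What holds in every reachable state: signatures in transit are not forged, packets sent by
correct processes are validly signed and delivered by their senders, messages of correct processes
are delivered only if they were signed, and signers have delivered their own messages. -/
structure Invariant (B : Finset V) (st : State V M) : Prop where
  unforged : ∀ p q k, (p, q, k) ∈ st.transit →
    k.sig.signer ∈ B ∨ (k.sig.signer, k.sig.content) ∈ st.signed
  sent : ∀ p q k, (p, q, k) ∈ st.transit → p ∉ B →
    k.Verif ∧ (p, k.sender, k.payload) ∈ st.delivered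
  created : ∀ q s m, (q, s, m) ∈ st.delivered → s ∉ B → (s, m) ∈ st.signed
  own : ∀ s m, (s, m) ∈ st.signed → (s, s, m) ∈ st.delivered

/-- Accepting unchecked packets from trusted neighbors is safe: those neighbors are correct, and
correct processes only send validly signed packets. -/
theorem Invariant.verif {st : State V M} (hI : Invariant B st) (hT : Disjoint B T) {p q : V}
    {k : Packet V M} (hk : (p, q, k) ∈ st.transit) (hacc : p ∈ T ∨ k.Verif) : k.Verif :=
  hacc.elim (fun hp => (hI.sent p q k hk fun hB => Finset.disjoint_left.1 hT hB hp).1) id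

variable [Fintype V]

theorem mem_sendAll {p a b : V} {X : Set V} {k l : Packet V M} :
    (a, b, l) ∈ sendAll G p X k ↔ a = p ∧ l = k ∧ G.Adj p b ∧ b ∉ X := by
  simp only [sendAll, Multiset.mem_map, Finset.mem_val, Finset.mem_filter, Finset.mem_univ,
    true_and, Prod.mk.injEq]
  constructor
  · rintro ⟨q, hq, rfl, rfl, rfl⟩
    exact ⟨rfl, rfl, hq⟩
  · rintro ⟨rfl, rfl, h⟩
    exact ⟨b, h, rfl, rfl, rfl⟩

theorem Invariant.step {st st' : State V M} {e : Event V M} {o : Option (V × V × M)}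
    (hT : Disjoint B T) (hI : Invariant B st) (h : Step G T B st e o st') :
    Invariant B st' := by
  cases h with
  | idle => exact hI
  | broadcast p m hp hnew =>
    refine ⟨?_, ?_, ?_, ?_⟩
    · intro a b k hk
      rcases Multiset.mem_add.1 hk with hk | hk
      · exact (hI.unforged a b k hk).imp id (Set.mem_insert_of_mem _)
      · obtain ⟨-, rfl, -⟩ := mem_sendAll.1 hk
        exact Or.inr (Set.mem_insert _ _)
    · intro a b k hk ha
      rcases Multiset.mem_add.1 hk with hk | hk
      · exact (hI.sent a b k hk ha).imp id (Set.mem_insert_of_mem _)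
      · obtain ⟨rfl, rfl, -⟩ := mem_sendAll.1 hk
        exact ⟨⟨rfl, rfl⟩, Set.mem_insert _ _⟩
    · intro q s n hd hs
      rcases Set.mem_insert_iff.1 hd with hd | hd
      · simp only [Prod.mk.injEq] at hd
        obtain ⟨-, rfl, rfl⟩ := hd
        exact Set.mem_insert _ _
      · exact Set.mem_insert_of_mem _ (hI.created q s n hd hs)
    · intro s n hs
      rcases Set.mem_insert_iff.1 hs with hs | hs
      · simp only [Prod.mk.injEq] at hs
        obtain ⟨rfl, rfl⟩ := hs
        exact Set.mem_insert _ _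
      · exact Set.mem_insert_of_mem _ (hI.own s n hs)
  | accept p q k rest hk hq hacc =>
    have hmem : (p, q, k) ∈ st.transit := hk ▸ Multiset.mem_cons_self _ _
    have hrest : ∀ x, x ∈ rest → x ∈ st.transit := fun x hx => hk ▸ Multiset.mem_cons_of_mem hx
    have hv := hI.verif hT hmem hacc.2
    refine ⟨?_, ?_, ?_, ?_⟩
    · intro a b l hl
      rcases Multiset.mem_add.1 hl with hl | hl
      · exact hI.unforged a b l (hrest _ hl)
      · obtain ⟨-, rfl, -⟩ := mem_sendAll.1 hl
        exact hI.unforged _ _ _ hmem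
    · intro a b l hl ha
      rcases Multiset.mem_add.1 hl with hl | hl
      · exact (hI.sent a b l (hrest _ hl) ha).imp id (Set.mem_insert_of_mem _)
      · obtain ⟨rfl, rfl, -⟩ := mem_sendAll.1 hl
        exact ⟨hv, Set.mem_insert _ _⟩
    · intro r s n hd hs
      rcases Set.mem_insert_iff.1 hd with hd | hd
      · simp only [Prod.mk.injEq] at hd
        obtain ⟨-, rfl, rfl⟩ := hd
        have h := hI.unforged _ _ _ hmem
        rw [hv.1, hv.2] at h
        exact h.resolve_left hs
      · exact hI.created r s n hd hs
    · exact fun s n hs => Set.mem_insert_of_mem _ (hI.own s n hs)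
  | discard p q k rest hk hq =>
    have hrest : ∀ x, x ∈ rest → x ∈ st.transit := fun x hx => hk ▸ Multiset.mem_cons_of_mem hx
    exact ⟨fun a b l hl => hI.unforged a b l (hrest _ hl),
      fun a b l hl => hI.sent a b l (hrest _ hl), hI.created, hI.own⟩
  | inject b q k hb hadj hsig =>
    refine ⟨?_, ?_, hI.created, hI.own⟩
    · intro a c l hl
      rcases Multiset.mem_cons.1 hl with hl | hl
      · simp only [Prod.mk.injEq] at hl
        obtain ⟨-, -, rfl⟩ := hl
        exact hsig
      · exact hI.unforged a c l hl
    · intro a c l hl ha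
      rcases Multiset.mem_cons.1 hl with hl | hl
      · simp only [Prod.mk.injEq] at hl
        obtain ⟨rfl, -, -⟩ := hl
        exact absurd hb ha
      · exact hI.sent a c l hl ha

theorem Execution.invariant (ex : Execution M G T B) (hT : Disjoint B T) (t : ℕ) :
    Invariant B (ex.state t) := by
  induction t with
  | zero =>
    rw [ex.init]
    exact ⟨by simp [State.init], by simp [State.init], by simp [State.init], by simp [State.init]⟩
  | succ t ih => exact ih.step hT (ex.step t)

theorem Step.delivered_iff {st st' : State V M} {e : Event V M} {o : Option (V × V × M)}
    (h : Step G T B st e o st') (x : V × V × M) :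
    x ∈ st'.delivered ↔ o = some x ∨ x ∈ st.delivered := by
  cases h <;> simp [eq_comm]

theorem Step.signed_iff {st st' : State V M} {e : Event V M} {o : Option (V × V × M)}
    (h : Step G T B st e o st') (s : V) (m : M) :
    (s, m) ∈ st'.signed ↔ e = .broadcast s m ∨ (s, m) ∈ st.signed := by
  cases h <;> simp [eq_comm]

/-- A broadcast is tested against `signed` only, not against `delivered`; `created` closes this gap,
since a correct process's own message can be delivered only after it was signed. -/
theorem Step.fresh_of_output {st st' : State V M} {e : Event V M} {x : V × V × M}
    (hI : Invariant B st) (h : Step G T B st e (some x) st') : x ∉ st.delivered := by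
  cases h with
  | broadcast p m hp hnew => exact fun hd => hnew (hI.created _ _ _ hd hp)
  | accept p q k rest hk hq hacc => exact hacc.1

theorem Execution.delivered_mono (ex : Execution M G T B) {t t' : ℕ} (h : t ≤ t')
    {x : V × V × M} (hx : x ∈ (ex.state t).delivered) : x ∈ (ex.state t').delivered := by
  induction t', h using Nat.le_induction with
  | base => exact hx
  | succ n _ ih => exact ((ex.step n).delivered_iff x).2 (Or.inr ih)

theorem Execution.exists_output (ex : Execution M G T B) {t : ℕ} {x : V × V × M}
    (hx : x ∈ (ex.state t).delivered) : ∃ t', ex.output t' = some x := by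
  induction t with
  | zero => simp [ex.init, State.init] at hx
  | succ t ih => exact (((ex.step t).delivered_iff x).1 hx).elim (fun h => ⟨t, h⟩) ih

theorem Execution.exists_broadcast (ex : Execution M G T B) {t : ℕ} {s : V} {m : M}
    (hx : (s, m) ∈ (ex.state t).signed) : ∃ t' < t, ex.event t' = .broadcast s m := by
  induction t with
  | zero => simp [ex.init, State.init] at hx
  | succ t ih =>
    rcases ((ex.step t).signed_iff s m).1 hx with h | h
    · exact ⟨t, t.lt_succ_self, h⟩
    · obtain ⟨t', ht', h⟩ := ih h
      exact ⟨t', ht'.trans t.lt_succ_self, h⟩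

theorem Execution.output_unique (ex : Execution M G T B) (hT : Disjoint B T) {x : V × V × M}
    {t t' : ℕ} (h : ex.output t = some x) (h' : ex.output t' = some x) : t' ≤ t := by
  by_contra! hlt
  have h1 : x ∈ (ex.state (t + 1)).delivered := ((ex.step t).delivered_iff x).2 (Or.inl h)
  have h2 := ex.step t'
  rw [h'] at h2
  exact h2.fresh_of_output (ex.invariant hT t') (ex.delivered_mono hlt h1)

theorem rcNoDuplication (M : Type*) (G : SimpleGraph V) (T : Finset V) (f : ℕ) :
    RCNoDuplication M G T f :=
  fun _ hB ex _ _ _ _ _ _ h h' =>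
    le_antisymm (ex.output_unique hB.1 h' h) (ex.output_unique hB.1 h h')

theorem rcNoCreation (M : Type*) (G : SimpleGraph V) (T : Finset V) (f : ℕ) :
    RCNoCreation M G T f := by
  intro B hB ex q _ s hs m t h
  have h1 := ((ex.step t).delivered_iff (q, s, m)).2 (Or.inl h)
  obtain ⟨t', ht', h2⟩ := ex.exists_broadcast ((ex.invariant hB.1 (t + 1)).created q s m h1 hs)
  exact ⟨t', Nat.lt_succ_iff.1 ht', h2⟩

/-- A packet received by a correct process from a correct neighbour is delivered, unless its
message was delivered before. -/
theorem Step.delivered_of_receive {st st' : State V M} {o : Option (V × V × M)} {p q : V}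
    {k : Packet V M} (hI : Invariant B st) (hp : p ∉ B) (hq : q ∉ B)
    (h : Step G T B st (.receive p q k) o st') : (q, k.sender, k.payload) ∈ st'.delivered := by
  cases h with
  | accept _ _ _ rest hk _ hacc => exact Set.mem_insert _ _
  | discard _ _ _ rest hk hna =>
    have hv := (hI.sent p q k (hk ▸ Multiset.mem_cons_self _ _) hp).1
    by_contra hd
    exact (hna.resolve_left hq) ⟨hd, Or.inr hv⟩

/-- A process that delivers a message sends it to all neighbours, except those from which
it was received and its broadcaster. -/
theorem Step.forward {st st' : State V M} {e : Event V M} {q s r : V} {m : M}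
    (hT : Disjoint B T) (hI : Invariant B st) (h : Step G T B st e (some (q, s, m)) st') (hs : s ∉ B) (hr : r ∉ B)
    (hadj : G.Adj q r) : (r, s, m) ∈ st'.delivered ∨
      ∃ k : Packet V M, k.sender = s ∧ k.payload = m ∧ (q, r, k) ∈ st'.transit := by
  by_cases hrs : (r, s, m) ∈ st'.delivered
  · exact Or.inl hrs
  refine Or.inr ?_
  cases h with
  | broadcast _ _ hp hnew =>
    exact ⟨signedPacket q m, rfl, rfl,
      Multiset.mem_add.2 (Or.inr (mem_sendAll.2 ⟨rfl, rfl, hadj, id⟩))⟩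
  | accept p _ k rest hk hq hacc =>
    refine ⟨k, rfl, rfl, Multiset.mem_add.2 (Or.inr (mem_sendAll.2 ⟨rfl, rfl, hadj, ?_⟩))⟩
    have hmem : (p, q, k) ∈ st.transit := hk ▸ Multiset.mem_cons_self _ _
    -- The two recipients left out have delivered already: the correct previous sender by `sent`,
    -- and the broadcaster by `own`, as the signature is genuine.
    rintro (rfl | rfl)
    · exact hrs (Set.mem_insert_of_mem _ (hI.sent _ _ _ hmem hr).2)
    · have hv := hI.verif hT hmem hacc.2
      have h := hI.unforged _ _ _ hmem
      rw [hv.1, hv.2] at h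
      exact hrs (Set.mem_insert_of_mem _ (hI.own _ _ (h.resolve_left hs)))

theorem rcValidity_of_reachIn {f : ℕ}
    (H : ∀ B, Faulty T f B → ∀ s ∉ B, ∀ q ∉ B, ReachIn G {x | x ∉ B} s q) :
    RCValidity M G T f := by
  intro B hB ex hfair s hs m t hbc q hq
  have hI := ex.invariant hB.1
  have hreach := H B hB s hs q hq
  clear hq
  -- Correctness of the current vertex is carried through the induction, because the next reception
  -- needs a correct sender.
  suffices h : q ∉ B ∧ ∃ t', (q, s, m) ∈ (ex.state t').delivered by
    obtain ⟨-, t', h⟩ := h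
    exact ex.exists_output h
  induction hreach with
  | refl =>
    refine ⟨hs, t + 1, (hI (t + 1)).own s m (((ex.step t).signed_iff s m).2 (Or.inl hbc))⟩
  | @tail q r _ hqr ih =>
    refine ⟨hqr.2, ?_⟩
    obtain ⟨hq, t', ht'⟩ := ih
    obtain ⟨t₁, ht₁⟩ := ex.exists_output ht'
    have hstep := ex.step t₁
    rw [ht₁] at hstep
    rcases hstep.forward hB.1 (hI t₁) hs hqr.2 hqr.1 with h | ⟨k, rfl, rfl, hk⟩
    · exact ⟨_, h⟩
    · obtain ⟨t₂, -, h₂⟩ := hfair (t₁ + 1) q r k hqr.2 hk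
      have hstep₂ := ex.step t₂
      rw [h₂] at hstep₂
      exact ⟨_, hstep₂.delivered_of_receive (hI t₂) hq hqr.2⟩

end Safety

/-! ### Executions with silent faulty processes, and necessity of reachability -/

section SilentExecution

variable {V M : Type*} [Fintype V] {G : SimpleGraph V} {T B : Finset V}

/-- All packets in transit carry the message `m` of `s`. -/
def Carries (s : V) (m : M) (st : State V M) : Prop :=
  ∀ p q k, (p, q, k) ∈ st.transit → k.sender = s ∧ k.payload = m

open Classical in
/-- A bound on the number of further receptions when only the message `m` of `s` circulates. -/
noncomputable def pending (s : V) (m : M) (st : State V M) : ℕ :=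
  (Finset.univ.filter fun q => (q, s, m) ∉ st.delivered).card * (Fintype.card V + 1) +
    Multiset.card st.transit

theorem card_sendAll_le (G : SimpleGraph V) (p : V) (X : Set V) (k : Packet V M) :
    Multiset.card (sendAll G p X k) ≤ Fintype.card V := by
  simp only [sendAll, Multiset.card_map]
  exact Finset.card_le_univ _

/-- A nonempty network can make progress by receiving a packet. -/
theorem exists_receive {s : V} {m : M} {st : State V M} (hc : Carries s m st)
    (hne : st.transit ≠ 0) :
    ∃ p q k o st', Step G T B st (.receive p q k) o st' ∧ Carries s m st' ∧
      pending s m st' < pending s m st := by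
  classical
  obtain ⟨⟨p, q, k⟩, hmem⟩ := Multiset.exists_mem_of_ne_zero hne
  obtain ⟨rest, hk⟩ := Multiset.exists_cons_of_mem hmem
  obtain ⟨rfl, rfl⟩ := hc p q k hmem
  have hrest : ∀ x, x ∈ rest → x ∈ st.transit := fun x hx => hk ▸ Multiset.mem_cons_of_mem hx
  by_cases h : q ∈ B ∨ ¬ Accepts T st p q k
  · refine ⟨p, q, k, _, _, .discard st p q k rest hk h, fun a b l hl => hc a b l (hrest _ hl), ?_⟩
    simp [pending, hk]
  · push Not at h
    refine ⟨p, q, k, _, _, .accept st p q k rest hk h.1 h.2, ?_, ?_⟩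
    · intro a b l hl
      rcases Multiset.mem_add.1 hl with hl | hl
      · exact hc a b l (hrest _ hl)
      · obtain ⟨-, rfl, -⟩ := mem_sendAll.1 hl
        exact ⟨rfl, rfl⟩
    -- An acceptance removes one process from the undelivered ones and one packet from transit, and
    -- adds at most `Fintype.card V` packets; the weight `Fintype.card V + 1` makes `pending` drop.
    · have hlt : (Finset.univ.filter fun r => (r, k.sender, k.payload) ∉
            insert (q, k.sender, k.payload) st.delivered).card + 1 ≤
          (Finset.univ.filter fun r => (r, k.sender, k.payload) ∉ st.delivered).card := by
        refine Finset.card_lt_card (Finset.ssubset_iff_of_subset ?_ |>.2 ⟨q, ?_, ?_⟩)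
        · intro r
          simp only [Finset.mem_filter, Finset.mem_univ, true_and]
          exact fun hr h => hr (Set.mem_insert_of_mem _ h)
        · simpa using h.2.1
        · simp
      have hs := card_sendAll_le G q {p, k.sender} k
      have hmul := Nat.mul_le_mul_right (Fintype.card V + 1) hlt
      simp only [pending, hk, Multiset.card_add, Multiset.card_cons]
      rw [Nat.add_mul, one_mul] at hmul
      omega

/-- The next step of an execution with silent faulty processes: a reception if possible. -/
theorem exists_next {s : V} {m : M} {st : State V M} (hc : Carries s m st) :
    ∃ e o st', Step G T B st e o st' ∧ Carries s m st' ∧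
      ((e = .idle ∧ st.transit = 0) ∨
        (∃ p q k, e = .receive p q k) ∧ pending s m st' < pending s m st) := by
  by_cases h : st.transit = 0
  · exact ⟨_, _, _, .idle st, hc, Or.inl ⟨rfl, h⟩⟩
  · obtain ⟨p, q, k, o, st', h1, h2, h3⟩ := exists_receive (G := G) (T := T) (B := B) hc h
    exact ⟨_, o, st', h1, h2, Or.inr ⟨⟨p, q, k, rfl⟩, h3⟩⟩

theorem Step.mem_transit {st st' : State V M} {e : Event V M} {o : Option (V × V × M)}
    (h : Step G T B st e o st') {x : V × V × Packet V M} (hx : x ∈ st.transit) :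
    e = .receive x.1 x.2.1 x.2.2 ∨ x ∈ st'.transit := by
  cases h with
  | idle => exact Or.inr hx
  | broadcast => exact Or.inr (Multiset.mem_add.2 (Or.inl hx))
  | accept p q k rest hk =>
    rw [hk, Multiset.mem_cons] at hx
    rcases hx with rfl | hx
    · exact Or.inl rfl
    · exact Or.inr (Multiset.mem_add.2 (Or.inl hx))
  | discard p q k rest hk =>
    rw [hk, Multiset.mem_cons] at hx
    rcases hx with rfl | hx
    · exact Or.inl rfl
    · exact Or.inr hx
  | inject => exact Or.inr (Multiset.mem_cons_of_mem hx)

variable (G T B) in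
/-- After a broadcast by `s`, there is a fair execution with silent faulty processes. -/
theorem exists_silent_execution {s : V} (hs : s ∉ B) (m : M) :
    ∃ ex : Execution M G T B, ex.Fair ∧ ex.event 0 = .broadcast s m ∧
      ∀ t, ex.event (t + 1) = .idle ∨ ∃ p q k, ex.event (t + 1) = .receive p q k := by
  let st₁ : State V M := ⟨insert (s, m) ∅, insert (s, s, m) ∅, 0 + sendAll G s ∅ (signedPacket s m)⟩
  have hstep₁ : Step G T B (State.init V M) (.broadcast s m) (some (s, s, m)) st₁ :=
    .broadcast (State.init V M) s m hs (by simp [State.init])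
  have hc₁ : Carries s m st₁ := by
    intro p q k hk
    obtain ⟨-, rfl, -⟩ := mem_sendAll.1 ((Multiset.mem_add.1 hk).resolve_left
      (Multiset.notMem_zero _))
    exact ⟨rfl, rfl⟩
  have : Nonempty (Event V M) := ⟨.idle⟩
  choose! ev out nxt hnext using
    fun (st : State V M) (hc : Carries s m st) => exists_next (G := G) (T := T) (B := B) hc
  let run : ℕ → State V M := fun t => nxt^[t] st₁
  have hrun : ∀ t, run (t + 1) = nxt (run t) := fun t => Function.iterate_succ_apply' nxt t st₁
  have hc : ∀ t, Carries s m (run t) := by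
    intro t
    induction t with
    | zero => exact hc₁
    | succ t ih => rw [hrun]; exact (hnext _ ih).2.1
  -- Time is shifted by one: the broadcast takes place at time 0, and time `t + 1` is `run t`.
  let ex : Execution M G T B :=
    { state := fun t => t.casesOn (State.init V M) run
      event := fun t => t.casesOn (.broadcast s m) fun t => ev (run t)
      output := fun t => t.casesOn (some (s, s, m)) fun t => out (run t)
      init := rfl
      step := by
        rintro (_ | t)
        · exact hstep₁
        · change Step G T B (run t) (ev (run t)) (out (run t)) (run (t + 1))
          rw [hrun]
          exact (hnext _ (hc t)).1 }
  -- The potential decreases at every reception, so the channels are empty at arbitrarily late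
  -- times.
  have hempty : ∀ n t, pending s m (run t) ≤ n → ∃ t' ≥ t, (run t').transit = 0 := by
    intro n
    induction n with
    | zero =>
      intro t ht
      refine ⟨t, le_rfl, ?_⟩
      have : Multiset.card (run t).transit = 0 := by simp only [pending] at ht; omega
      exact Multiset.card_eq_zero.1 this
    | succ n ih =>
      intro t ht
      rcases (hnext _ (hc t)).2.2 with h | h
      · exact ⟨t, le_rfl, h.2⟩
      · obtain ⟨t', ht', h'⟩ := ih (t + 1) (by rw [hrun]; omega)
        exact ⟨t', by omega, h'⟩
  refine ⟨ex, ?_, rfl, ?_⟩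
  · intro t p q k _ hk
    cases t with
    | zero => exact absurd hk (Multiset.notMem_zero _)
    | succ t =>
      -- A packet that is never received stays in transit forever, contradicting `hempty`.
      by_contra hno
      obtain ⟨t', ht', h0⟩ := hempty _ t le_rfl
      have hstay : ∀ n ≥ t, (p, q, k) ∈ (run n).transit := by
        intro n hn
        induction n, hn using Nat.le_induction with
        | base => exact hk
        | succ n hn ih =>
          have hn' := (ex.step (n + 1)).mem_transit ih
          exact hn'.resolve_left fun h => hno ⟨n + 1, by omega, h⟩
      exact Multiset.notMem_zero _ (h0 ▸ hstay t' ht')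
  · intro t
    exact (hnext _ (hc t)).2.2.imp And.left And.left

/-- If the faulty processes are silent, a set closed under moving to correct neighbours confines
deliveries. -/
theorem Step.confined {X : Set V} (hX : ∀ x ∈ X, ∀ y ∉ B, G.Adj x y → y ∈ X) {st st' : State V M}
    {e : Event V M} {o : Option (V × V × M)} (h : Step G T B st e o st')
    (he : (∃ s ∈ X, ∃ m, e = .broadcast s m) ∨ e = .idle ∨ ∃ p q k, e = .receive p q k)
    (h1 : ∀ p q k, (p, q, k) ∈ st.transit → p ∈ X ∧ G.Adj p q)
    (h2 : ∀ q s m, (q, s, m) ∈ st.delivered → q ∈ X) :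
    (∀ p q k, (p, q, k) ∈ st'.transit → p ∈ X ∧ G.Adj p q) ∧
      ∀ q s m, (q, s, m) ∈ st'.delivered → q ∈ X := by
  cases h with
  | idle => exact ⟨h1, h2⟩
  | broadcast s m hs hnew =>
    obtain ⟨s', hs', m', he⟩ : ∃ s' ∈ X, ∃ m', Event.broadcast s m = .broadcast s' m' := by
      simpa using he
    cases he
    refine ⟨fun p q k hk => ?_, fun q s' n hd => ?_⟩
    · rcases Multiset.mem_add.1 hk with hk | hk
      · exact h1 p q k hk
      · obtain ⟨rfl, -, hadj, -⟩ := mem_sendAll.1 hk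
        exact ⟨hs', hadj⟩
    · rcases Set.mem_insert_iff.1 hd with hd | hd
      · cases hd
        exact hs'
      · exact h2 q s' n hd
  | accept p q k rest hk hq hacc =>
    have hpq := h1 p q k (hk ▸ Multiset.mem_cons_self _ _)
    have hqX := hX p hpq.1 q hq hpq.2
    refine ⟨fun a b l hl => ?_, fun r s' n hd => ?_⟩
    · rcases Multiset.mem_add.1 hl with hl | hl
      · exact h1 a b l (hk ▸ Multiset.mem_cons_of_mem hl)
      · obtain ⟨rfl, -, hadj, -⟩ := mem_sendAll.1 hl
        exact ⟨hqX, hadj⟩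
    · rcases Set.mem_insert_iff.1 hd with hd | hd
      · cases hd
        exact hqX
      · exact h2 r s' n hd
  | discard p q k rest hk hq =>
    exact ⟨fun a b l hl => h1 a b l (hk ▸ Multiset.mem_cons_of_mem hl), h2⟩
  | inject => simp at he

/-- The set of vertices reached from `s` through correct ones is closed under moving to correct
neighbors, so in a silent execution no other process can deliver. -/
theorem reachIn_of_rcValidity [Nonempty M] {f : ℕ} (H : RCValidity M G T f) (hB : Faulty T f B)
    {s q : V} (hs : s ∉ B) (hq : q ∉ B) : ReachIn G {x | x ∉ B} s q := by
  obtain ⟨m⟩ := ‹Nonempty M›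
  obtain ⟨ex, hfair, h0, hsilent⟩ := exists_silent_execution G T B hs m
  obtain ⟨t', ht'⟩ := H B hB ex hfair s hs m 0 h0 q hq
  have hX : ∀ x ∈ {x | ReachIn G {x | x ∉ B} s x}, ∀ y ∉ B, G.Adj x y →
      y ∈ {x | ReachIn G {x | x ∉ B} s x} := fun x hx y hy hxy =>
    Relation.ReflTransGen.tail hx ⟨hxy, hy⟩
  have hinv : ∀ t, (∀ p r k, (p, r, k) ∈ (ex.state t).transit →
        p ∈ {x | ReachIn G {x | x ∉ B} s x} ∧ G.Adj p r) ∧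
      ∀ r l n, (r, l, n) ∈ (ex.state t).delivered → r ∈ {x | ReachIn G {x | x ∉ B} s x} := by
    intro t
    induction t with
    | zero => rw [ex.init]; exact ⟨by simp [State.init], by simp [State.init]⟩
    | succ t ih =>
      refine (ex.step t).confined hX ?_ ih.1 ih.2
      cases t with
      | zero => exact Or.inl ⟨s, Relation.ReflTransGen.refl, m, h0⟩
      | succ t => exact Or.inr (hsilent t)
  exact (hinv (t' + 1)).2 q s m (((ex.step t').delivered_iff _).2 (Or.inl ht'))

theorem rcValidity_iff_reachIn [Nonempty M] {f : ℕ} : RCValidity M G T f ↔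
    ∀ B, Faulty T f B → ∀ s ∉ B, ∀ q ∉ B, ReachIn G {x | x ∉ B} s q :=
  ⟨fun H _ hB _ hs _ hq => reachIn_of_rcValidity H hB hs hq, rcValidity_of_reachIn⟩

end SilentExecution

/-! ### Menger's theorem via Hall's theorem -/

section Menger

variable {V : Type*}

theorem ReachIn.exists_walk {G : SimpleGraph V} {X : Set V} {a b : V} (ha : a ∈ X)
    (h : ReachIn G X a b) : ∃ p : G.Walk a b, ∀ x ∈ p.support, x ∈ X := by
  induction h with
  | refl => exact ⟨.nil, by simpa using ha⟩
  | @tail c d _ hcd ih =>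
    obtain ⟨p, hp⟩ := ih
    refine ⟨p.concat hcd.1, fun x hx => ?_⟩
    rw [SimpleGraph.Walk.support_concat, List.mem_append] at hx
    rcases hx with hx | hx
    · exact hp x hx
    · rw [List.mem_singleton] at hx
      exact hx ▸ hcd.2

theorem ReachIn.exists_path {G : SimpleGraph V} {X : Set V} {a b : V} (ha : a ∈ X)
    (h : ReachIn G X a b) : ∃ p : G.Path a b, ∀ x ∈ p.1.support, x ∈ X := by
  classical
  obtain ⟨p, hp⟩ := h.exists_walk ha
  exact ⟨p.toPath, fun x hx => hp x (p.support_toPath_subset_support hx)⟩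

theorem reachIn_of_walk {G : SimpleGraph V} {X : Set V} {a b : V} (p : G.Walk a b)
    (hp : ∀ x ∈ p.support, x ∈ X) : ReachIn G X a b := by
  induction p with
  | nil => exact .refl
  | @cons a c b h p ih =>
    simp only [SimpleGraph.Walk.support_cons, List.mem_cons, forall_eq_or_imp] at hp
    exact Relation.ReflTransGen.head ⟨h, hp.2 c p.start_mem_support⟩ (ih hp.2)

/-- A set of fewer vertices than paths misses one of the paths. -/
theorem InternallyDisjoint.reachIn {H : SimpleGraph V} {u v : V} {P : Finset (H.Path u v)}
    (hP : InternallyDisjoint P) {S : Finset V} (hu : u ∉ S) (hv : v ∉ S) (hS : S.card < P.card) :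
    ReachIn H {x | x ∉ S} u v := by
  by_contra hno
  have hmeet : ∀ p ∈ P, ∃ x ∈ S, x ∈ p.1.support := by
    intro p _
    by_contra! h
    exact hno (reachIn_of_walk p.1 fun x hx hxS => h x hxS hx)
  have : Nonempty V := ⟨u⟩
  choose! x hxS hxp using hmeet
  -- Sending each path to a vertex of `S` on it is injective: distinct paths share only `u` and `v`,
  -- and neither is in `S`.
  refine hS.not_ge (Finset.card_le_card_of_injOn x hxS fun p hp q hq hpq => ?_)
  by_contra hne
  rcases hP p hp q hq hne (x p) (hxp p hp) (hpq ▸ hxp q hq) with h | h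
  · exact hu (h ▸ hxS p hp)
  · exact hv (h ▸ hxS p hp)

/-- Writing the bound as `k + 1` turns it into a strict inequality below a supremum, which a single
family witnesses; attainment of the supremum is not needed. -/
theorem le_kappa_iff {H : SimpleGraph V} {u v : V} {k : ℕ} :
    ((k + 1 : ℕ) : ℕ∞) ≤ kappa H u v ↔
      ∃ P : Finset (H.Path u v), InternallyDisjoint P ∧ k + 1 ≤ P.card := by
  rw [Nat.cast_add, Nat.cast_one, ENat.add_one_le_iff (ENat.natCast_ne_top k), kappa, lt_iSup_iff]
  simp only [Subtype.exists, Nat.cast_lt, Nat.succ_le_iff, exists_prop]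

/-- A vertex cut of `H` is obtained from a cut between the neighbourhoods of `u` and `v`. -/
theorem le_card_of_separates {H : SimpleGraph V} {u v : V} {k : ℕ} (huv : u ≠ v)
    (hadj : ¬ H.Adj u v)
    (hsep : ∀ S : Finset V, u ∉ S → v ∉ S → S.card < k → ReachIn H {x | x ∉ S} u v)
    {Z W : Finset V} (hZ : ∀ x ∈ Z, ¬ H.Adj x v)
    (hW : ∀ y, y ∈ W ↔ (H.Adj u y ∨ ∃ x ∈ Z, H.Adj x y ∧ y ≠ u ∧ y ≠ v) ∧ y ∉ Z) :
    k ≤ W.card := by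
  classical
  by_contra! hlt
  have hreach := hsep (W \ {u, v}) (by simp) (by simp)
    ((Finset.card_le_card Finset.sdiff_subset).trans_lt hlt)
  -- `W` contains every vertex outside `Z` that can be entered from `u` or `Z`, apart from `u` and
  -- `v` themselves, so a walk avoiding it stays in `Z ∪ {u}`; from there no edge leads to `v`.
  have hinv : ∀ w, ReachIn H {x | x ∉ W \ {u, v}} u w → w = u ∨ (w ∈ Z ∧ w ≠ v) := by
    intro w hw
    induction hw with
    | refl => exact Or.inl rfl
    | @tail x y _ hxy ih =>
      by_cases hyu : y = u
      · exact Or.inl hyu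
      have hyv : y ≠ v := by
        rintro rfl
        rcases ih with rfl | ih
        · exact hadj hxy.1
        · exact hZ x ih.1 hxy.1
      refine Or.inr ⟨?_, hyv⟩
      by_contra hyZ
      refine hxy.2 ?_
      simp only [Finset.mem_sdiff, hW, Finset.mem_insert, Finset.mem_singleton]
      refine ⟨⟨?_, hyZ⟩, not_or.2 ⟨hyu, hyv⟩⟩
      rcases ih with rfl | ih
      · exact Or.inl hxy.1
      · exact Or.inr ⟨x, ih.1, hxy.1, hyu, hyv⟩
  exact (hinv v hreach).elim (fun h => huv h.symm) fun h => h.2 rfl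

section Orbits

variable {E : V → V → Prop}

/-- Tracing back from `w` is forced at each step, and can stop neither early nor late, as `a` and
`b` have no predecessor. -/
theorem orbits_disjoint (hinj : ∀ x y z, E x z → E y z → x = y) {a b w : V}
    (ha : ∀ x, ¬ E x a) (hb : ∀ x, ¬ E x b) (haw : Relation.ReflTransGen E a w)
    (hbw : Relation.ReflTransGen E b w) : a = b := by
  induction haw with
  | refl =>
    cases hbw with
    | refl => rfl
    | tail _ h => exact absurd h (ha _)
  | tail _ h ih =>
    cases hbw with
    | refl => exact absurd h (hb _)
    | tail hbw h' => exact ih (hinj _ _ _ h h' ▸ hbw)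

variable [Finite V]

/-- If `E` is a backward deterministic relation on a finite type, a point without predecessor is led
to a point without successor. -/
theorem exists_terminal (hinj : ∀ x y z, E x z → E y z → x = y)
    {a : V} (ha : ∀ x, ¬ E x a) :
    ∃ e, Relation.ReflTransGen E a e ∧ ∀ y, ¬ E e y := by
  -- Otherwise a choice of successors is an injective self-map of the finite orbit of `a`, hence
  -- surjective, and `a` would have a predecessor.
  by_contra! hno
  choose g hg using fun e : {e // Relation.ReflTransGen E a e} => hno e.1 e.2
  let F : {e // Relation.ReflTransGen E a e} → {e // Relation.ReflTransGen E a e} :=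
    fun e => ⟨g e, e.2.tail (hg e)⟩
  have hF : Function.Injective F := fun x y hxy =>
    Subtype.ext (hinj _ _ _ (hg x) (by rw [show g x = g y from congrArg Subtype.val hxy]; exact hg y))
  obtain ⟨x, hx⟩ := Finite.injective_iff_surjective.1 hF ⟨a, .refl⟩
  have hxa : g x = a := congrArg Subtype.val hx
  have hgx := hg x
  rw [hxa] at hgx
  exact ha x.1 hgx

end Orbits

variable [Fintype V]

/-- If every set separating `A` from `C` has at least `k` elements, then `k` points of `A` are
joined to points of `C` along disjoint orbits of a backward deterministic relation, each step of which
follows the relation `R`. -/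
theorem exists_linkage (R : V → V → Prop) (A C : Finset V) (k : ℕ)
    (hsep : ∀ Z W : Finset V, (∀ x ∈ Z, x ∉ C) →
      (∀ y, y ∈ W ↔ (y ∈ A ∨ ∃ x ∈ Z, R x y) ∧ y ∉ Z) → k ≤ W.card) :
    ∃ (E : V → V → Prop) (A' : Finset V), A' ⊆ A ∧ k ≤ A'.card ∧
      (∀ x y, E x y → x = y ∨ R x y) ∧ (∀ a ∈ A, ∀ x, ¬ E x a) ∧
      (∀ x y z, E x z → E y z → x = y) ∧ ∀ a ∈ A', ∃ c ∈ C, Relation.ReflTransGen E a c := by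
  classical
  -- For `Z = ∅` the separating set is `A` itself.
  have hkA : k ≤ A.card := by
    simpa using hsep ∅ A
  let N : Finset V → Finset V := fun Z => Z ∪ Finset.univ.filter fun y => ∃ x ∈ Z, R x y
  -- A vertex outside `C` may be matched to itself or an `R`-successor, provided the target is
  -- outside `A`, or to one of `A.card - k` dummies. Being matched to itself means staying off the
  -- paths.
  let t : {v // v ∉ C} → Finset (V ⊕ Fin (A.card - k)) := fun v =>
    (N {v.1} \ A).disjSum Finset.univ
  have hall : ∀ s : Finset {v // v ∉ C}, s.card ≤ (s.biUnion t).card := by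
    intro s
    rcases s.eq_empty_or_nonempty with rfl | ⟨v₀, hv₀⟩
    · simp
    let Z : Finset V := s.map (Function.Embedding.subtype _)
    have hZ : ∀ x ∈ Z, x ∉ C := by
      intro x hx
      obtain ⟨y, -, rfl⟩ := Finset.mem_map.1 hx
      exact y.2
    have hsub : (N Z \ A).disjSum Finset.univ ⊆ s.biUnion t := by
      intro y hy
      rw [Finset.mem_biUnion]
      rcases y with y | d
      · simp only [Finset.inl_mem_disjSum, N, Finset.mem_sdiff, Finset.mem_union,
          Finset.mem_filter, Finset.mem_univ, true_and] at hy
        obtain ⟨hy | ⟨x, hx, hxy⟩, hyA⟩ := hy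
        · obtain ⟨v, hv, rfl⟩ := Finset.mem_map.1 hy
          exact ⟨v, hv, by simpa [t, N] using hyA⟩
        · obtain ⟨v, hv, rfl⟩ := Finset.mem_map.1 hx
          refine ⟨v, hv, ?_⟩
          simp only [t, N, Finset.inl_mem_disjSum, Finset.mem_sdiff, Finset.mem_union,
            Finset.mem_singleton, Finset.mem_filter, Finset.mem_univ, true_and, exists_eq_left]
          exact ⟨Or.inr hxy, hyA⟩
      · exact ⟨v₀, hv₀, by simp [t]⟩
    have h1 := Finset.card_le_card hsub
    rw [Finset.card_disjSum, Finset.card_univ, Fintype.card_fin] at h1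
    -- Separation by `(A ∪ N Z) \ Z` gives `Z.card + k ≤ A.card + (N Z \ A).card`, which is Hall's
    -- inequality once the dummies are counted.
    have h2 := hsep Z ((A ∪ N Z) \ Z) hZ fun y => by
      simp only [N, Finset.mem_sdiff, Finset.mem_union, Finset.mem_filter, Finset.mem_univ,
        true_and]
      tauto
    have h4 : Z ⊆ A ∪ N Z := Finset.subset_union_left.trans Finset.subset_union_right
    rw [Finset.card_sdiff_of_subset h4] at h2
    have h5 : (A ∪ N Z).card = A.card + (N Z \ A).card := by
      rw [← Finset.card_union_of_disjoint Finset.disjoint_sdiff, Finset.union_sdiff_self_eq_union]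
    have h6 : Z.card = s.card := Finset.card_map _
    have h7 := Finset.card_le_card h4
    omega
  obtain ⟨m, hm, hmt⟩ := (Finset.all_card_le_biUnion_card_iff_exists_injective t).1 hall
  -- Dummies are dropped here. Injectivity of the matching makes `E` backward deterministic, and its
  -- targets avoid `A`.
  let E : V → V → Prop := fun x y => ∃ h : x ∉ C, m ⟨x, h⟩ = Sum.inl y
  have hinj : ∀ x y z, E x z → E y z → x = y := by
    rintro x y z ⟨h, h1⟩ ⟨h', h2⟩
    exact congrArg Subtype.val (hm (h1.trans h2.symm))
  have hE : ∀ x y, E x y → (x = y ∨ R x y) ∧ y ∉ A := by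
    rintro x y ⟨h, hxy⟩
    have := hmt ⟨x, h⟩
    rw [hxy] at this
    simp only [t, N, Finset.inl_mem_disjSum, Finset.mem_sdiff, Finset.mem_union,
      Finset.mem_singleton, Finset.mem_filter, Finset.mem_univ, true_and, exists_eq_left] at this
    exact ⟨this.1.imp Eq.symm id, this.2⟩
  have hA : ∀ a ∈ A, ∀ x, ¬ E x a := fun a ha x h => (hE x a h).2 ha
  choose! e he hend using fun a (ha : a ∈ A) => exists_terminal hinj (hA a ha)
  have heinj : Set.InjOn e A := fun a ha b hb hab =>
    orbits_disjoint hinj (hA a ha) (hA b hb) (he a ha) (hab ▸ he b hb)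
  -- An orbit ending outside `C` ends at a vertex matched to a dummy. Distinct starts have distinct
  -- ends, so at most `A.card - k` orbits miss `C`.
  have hbad : (A.filter fun a => e a ∉ C).card ≤ A.card - k := by
    have hd : ∀ a : {a // a ∈ A.filter fun a => e a ∉ C}, ∃ d,
        m ⟨e a, (Finset.mem_filter.1 a.2).2⟩ = Sum.inr d := by
      rintro ⟨a, ha⟩
      rcases h : m ⟨e a, (Finset.mem_filter.1 ha).2⟩ with y | d
      · exact absurd ⟨_, h⟩ (hend a (Finset.mem_filter.1 ha).1 y)
      · exact ⟨d, rfl⟩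
    choose d hd using hd
    have hdinj : Function.Injective d := by
      intro a b hab
      have h := hm ((hd a).trans (by rw [hab, hd b]))
      exact Subtype.ext (heinj (Finset.mem_filter.1 a.2).1 (Finset.mem_filter.1 b.2).1
        (congrArg Subtype.val h))
    have hcard := Fintype.card_le_of_injective d hdinj
    rwa [Fintype.card_coe, Fintype.card_fin] at hcard
  refine ⟨E, A.filter fun a => e a ∈ C, Finset.filter_subset _ _, ?_, fun x y h => (hE x y h).1,
    hA, hinj, fun a ha => ⟨e a, (Finset.mem_filter.1 ha).2, he a (Finset.mem_filter.1 ha).1⟩⟩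
  have := Finset.card_filter_add_card_filter_not (s := A) (fun a => e a ∈ C)
  omega

/-- **Menger's theorem**: if `u` and `v` are not adjacent and no set of fewer than `k` further
vertices separates them, there are `k` internally disjoint `u`–`v` paths. -/
theorem exists_internallyDisjoint {H : SimpleGraph V} {u v : V} {k : ℕ} (huv : u ≠ v)
    (hadj : ¬ H.Adj u v)
    (hsep : ∀ S : Finset V, u ∉ S → v ∉ S → S.card < k → ReachIn H {x | x ∉ S} u v) :
    ∃ P : Finset (H.Path u v), InternallyDisjoint P ∧ k ≤ P.card := by
  classical
  -- The linkage runs from the neighbors of `u` to those of `v`, and `R` forbids entering `u` or `v`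
  -- on the way.
  obtain ⟨E, A', hA', hk, hER, hA, hinj, hC⟩ := exists_linkage
    (fun x y => H.Adj x y ∧ y ≠ u ∧ y ≠ v) (Finset.univ.filter fun x => H.Adj u x)
    (Finset.univ.filter fun x => H.Adj x v) k fun Z W hZ hW =>
      le_card_of_separates (Z := Z) huv hadj hsep (by simpa using hZ) (by simpa using hW)
  have horb : ∀ a ∈ A', ∀ w, Relation.ReflTransGen E a w →
      (w ≠ u ∧ w ≠ v) ∧ ReachIn H {x | x = u ∨ x = v ∨ Relation.ReflTransGen E a x} u w := by
    intro a ha w hw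
    have hua : H.Adj u a := (Finset.mem_filter.1 (hA' ha)).2
    induction hw with
    | refl =>
      refine ⟨⟨hua.ne', ?_⟩, Relation.ReflTransGen.single ⟨hua, Or.inr (Or.inr .refl)⟩⟩
      rintro rfl
      exact hadj hua
    | @tail x y hx hxy ih =>
      rcases hER x y hxy with rfl | h
      · exact ih
      · exact ⟨h.2, ih.2.tail ⟨h.1, Or.inr (Or.inr (hx.tail hxy))⟩⟩
  have hpath : ∀ a : A', ∃ p : H.Path u v,
      ∀ x ∈ p.1.support, x = u ∨ x = v ∨ Relation.ReflTransGen E a x := by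
    rintro ⟨a, ha⟩
    obtain ⟨c, hc, hac⟩ := hC a ha
    have hcv : H.Adj c v := (Finset.mem_filter.1 hc).2
    have hr := (horb a ha c hac).2
    exact ReachIn.exists_path (Or.inl rfl) (hr.tail ⟨hcv, Or.inr (Or.inl rfl)⟩)
  choose path hpath using hpath
  have hcommon : ∀ a b, a ≠ b → ∀ w, w ∈ (path a).1.support → w ∈ (path b).1.support →
      w = u ∨ w = v := by
    intro a b hab w hwa hwb
    rcases hpath a w hwa with h | h | h
    · exact Or.inl h
    · exact Or.inr h
    rcases hpath b w hwb with h' | h' | h'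
    · exact Or.inl h'
    · exact Or.inr h'
    exact absurd (Subtype.ext (orbits_disjoint hinj (hA a (hA' a.2)) (hA b (hA' b.2)) h h')) hab
  -- Two equal paths would share their second vertex, which is neither `u` nor `v`, since these are
  -- not adjacent.
  have hpinj : Function.Injective path := by
    intro a b hab
    by_contra hne
    have hs := (path a).1.adj_snd (SimpleGraph.Walk.not_nil_of_ne huv)
    have hmem : (path a).1.snd ∈ (path a).1.support := (path a).1.getVert_mem_support 1
    rcases hcommon a b hne _ hmem (hab ▸ hmem) with h | h
    · exact hs.ne' h
    · exact hadj (h ▸ hs)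
  refine ⟨Finset.univ.image path, ?_, ?_⟩
  · intro p hp q hq hpq
    obtain ⟨a, -, rfl⟩ := Finset.mem_image.1 hp
    obtain ⟨b, -, rfl⟩ := Finset.mem_image.1 hq
    exact hcommon a b fun h => hpq (h ▸ rfl)
  · rwa [Finset.card_image_of_injective _ hpinj, Finset.card_univ, Fintype.card_coe]

/-- Connectivity criterion for two vertices of a graph. -/
theorem reachIn_iff_adj_or_le_kappa {H : SimpleGraph V} {u v : V} {f : ℕ} (huv : u ≠ v) :
    (∀ S : Finset V, u ∉ S → v ∉ S → S.card ≤ f → ReachIn H {x | x ∉ S} u v) ↔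
      H.Adj u v ∨ ((f + 1 : ℕ) : ℕ∞) ≤ kappa H u v := by
  rw [le_kappa_iff]
  constructor
  · intro h
    by_cases hadj : H.Adj u v
    · exact Or.inl hadj
    · exact Or.inr (exists_internallyDisjoint huv hadj fun S hu hv hS =>
        h S hu hv (Nat.lt_succ_iff.1 hS))
  · rintro (h | ⟨P, hP, hk⟩) S hu hv hS
    · exact Relation.ReflTransGen.single ⟨h, hv⟩
    · exact hP.reachIn hu hv (by omega)

end Menger

/-! ### Contraction of trusted vertices -/

section Inserted

variable {V : Type*}

/-- The graph `f(G)` with `u` and `v` inserted if they are trusted, on the vertex set `V`. -/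
def insertedGraph (G : SimpleGraph V) (T : Finset V) (u v : V) : SimpleGraph V where
  Adj a b := a ≠ b ∧ (a ∉ T ∨ a = u ∨ a = v) ∧ (b ∉ T ∨ b = u ∨ b = v) ∧ Linked G T a b
  symm := ⟨fun _ _ h => ⟨h.1.symm, h.2.2.1, h.2.1, h.2.2.2.symm⟩⟩
  loopless := ⟨fun _ h => h.1 rfl⟩

variable {G : SimpleGraph V} {T : Finset V} {u v : V}

/-- Puts both cases of `Linked` into one form, a trusted walk and a last edge, suited to induction
on `ReachIn`. -/
theorem linked_iff {a c : V} : Linked G T a c ↔ ∃ b, ReachIn G T a b ∧ G.Adj b c := by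
  constructor
  · rintro (h | ⟨n, p, hT, h0, hn, hs⟩)
    · exact ⟨a, .refl, h⟩
    · have : ∀ i ≤ n, ReachIn G T a (p i) := by
        intro i
        induction i with
        | zero => exact fun _ => Relation.ReflTransGen.single ⟨h0, hT 0 (Nat.zero_le n)⟩
        | succ i ih => exact fun hi => (ih (by omega)).tail ⟨hs i (by omega), hT _ hi⟩
      exact ⟨p n, this n le_rfl, hn⟩
  · rintro ⟨b, hab, hbc⟩
    induction hab generalizing c with
    | refl => exact Or.inl hbc
    | @tail x b _ hxb ih =>
      rcases ih hxb.1 with h | ⟨n, p, hT, h0, hn, hs⟩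
      · exact Or.inr ⟨0, fun _ => b, fun _ _ => hxb.2, h, hbc, by simp⟩
      · refine Or.inr ⟨n + 1, fun i => if i ≤ n then p i else b, ?_, ?_, ?_, ?_⟩
        · intro i _
          dsimp only
          split_ifs with hi
          · exact hT i hi
          · exact hxb.2
        · simpa using h0
        · simpa using hbc
        · intro i hi
          rcases Nat.lt_or_ge i n with h | h
          · have h' : i + 1 ≤ n := h
            simpa [h.le, h'] using hs i h
          · obtain rfl : i = n := by omega
            simpa using hn

/-- Together with the next two lemmas, this replaces the graphs attached to the different trust
cases by the single `insertedGraph`, symmetric in `u` and `v`. -/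
theorem untrustedGraph_spanningCoe (hu : u ∉ T) (hv : v ∉ T) :
    (untrustedGraph G T).spanningCoe = insertedGraph G T u v := by
  ext a b
  simp only [SimpleGraph.Subgraph.spanningCoe_adj, untrustedGraph, insertedGraph]
  have h1 : a = u → a ∉ T := fun h => h ▸ hu
  have h2 : a = v → a ∉ T := fun h => h ▸ hv
  have h3 : b = u → b ∉ T := fun h => h ▸ hu
  have h4 : b = v → b ∉ T := fun h => h ▸ hv
  tauto

theorem addNode_spanningCoe (hv : v ∉ T) :
    (addNode G T (untrustedGraph G T) u).spanningCoe = insertedGraph G T u v := by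
  ext a b
  simp only [SimpleGraph.Subgraph.spanningCoe_adj, untrustedGraph, insertedGraph, addNode,
    Set.mem_ofPred_eq]
  have h5 : Linked G T b a ↔ Linked G T a b := ⟨Linked.symm, Linked.symm⟩
  grind

theorem addNode_addNode_spanningCoe :
    (addNode G T (addNode G T (untrustedGraph G T) u) v).spanningCoe = insertedGraph G T u v := by
  ext a b
  simp only [SimpleGraph.Subgraph.spanningCoe_adj, untrustedGraph, insertedGraph, addNode,
    Set.mem_ofPred_eq, Set.mem_insert_iff]
  have h5 : Linked G T b a ↔ Linked G T a b := ⟨Linked.symm, Linked.symm⟩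
  grind

theorem insertedGraph_comm : insertedGraph G T u v = insertedGraph G T v u := by
  ext a b
  simp only [insertedGraph, or_comm]

theorem ReachIn.of_insertedGraph {X Y : Set V} {a b : V} (hX : X ⊆ Y) (hT : ↑T ⊆ Y)
    (h : ReachIn (insertedGraph G T u v) X a b) : ReachIn G Y a b := by
  induction h with
  | refl => exact .refl
  | tail _ hcd ih =>
    obtain ⟨x, hx, hxd⟩ := linked_iff.1 hcd.1.2.2.2
    exact (ih.trans (hx.mono hT)).tail ⟨hxd, hX hcd.2⟩

theorem ReachIn.insertedGraph {X Y : Set V} (hX : ∀ x ∈ X, x ∉ T → x ∈ Y) (hvY : v ∈ Y)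
    (h : ReachIn G X u v) : ReachIn (insertedGraph G T u v) Y u v := by
  -- Here `y` is the last vertex of the contracted graph reached so far, and the walk has since met
  -- trusted vertices only. If `v` is trusted, one more edge from `y` to `v` is added at the end.
  have hinv : ∀ w, ReachIn G X u w → ∃ y, ReachIn (SigFloodT.insertedGraph G T u v) Y u y ∧
      (y ∉ T ∨ y = u ∨ y = v) ∧ ReachIn G T y w := by
    intro w hw
    induction hw with
    | refl => exact ⟨u, .refl, Or.inr (Or.inl rfl), .refl⟩
    | @tail x w _ hxw ih =>
      obtain ⟨y, huy, hy, hyx⟩ := ih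
      by_cases hw : w ∈ T
      · exact ⟨y, huy, hy, hyx.tail ⟨hxw.1, hw⟩⟩
      · refine ⟨w, ?_, Or.inl hw, .refl⟩
        by_cases hyw : y = w
        · exact hyw ▸ huy
        · exact huy.tail ⟨⟨hyw, hy, Or.inl hw, linked_iff.2 ⟨x, hyx, hxw.1⟩⟩, hX w hxw.2 hw⟩
  obtain ⟨y, huy, hy, hyv⟩ := hinv v h
  by_cases hne : y = v
  · exact hne ▸ huy
  · refine huy.tail ⟨⟨hne, hy, Or.inr (Or.inr rfl), ?_⟩, hvY⟩
    cases hyv with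
    | refl => exact absurd rfl hne
    | tail h1 h2 => exact linked_iff.2 ⟨_, h1, h2.1⟩

/-- Faulty processes separate `u` from `v` in `G` iff they do so after the contraction of the
trusted processes. -/
theorem forall_faulty_reachIn_iff {f : ℕ} :
    (∀ B, Faulty T f B → u ∉ B → v ∉ B → ReachIn G {x | x ∉ B} u v) ↔
      ∀ S : Finset V, u ∉ S → v ∉ S → S.card ≤ f →
        ReachIn (insertedGraph G T u v) {x | x ∉ S} u v := by
  classical
  constructor
  · intro h S hu hv hS
    -- A cut `S` may contain trusted vertices; dropping them gives an admissible faulty set.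
    refine (h (S \ T) ⟨Finset.sdiff_disjoint, (Finset.card_le_card Finset.sdiff_subset).trans hS⟩
      (by simp [hu]) (by simp [hv])).insertedGraph ?_ hv
    simp only [Set.mem_ofPred_eq, Finset.mem_sdiff]
    tauto
  · intro h B hB hu hv
    exact (h B hu hv hB.2).of_insertedGraph subset_rfl
      fun x hx hxB => Finset.disjoint_left.1 hB.1 hxB hx

end Inserted

/-! ### Unit flows along walks in the split digraph -/

section Flow

variable {V : Type*}

open Classical in
/-- How often the walk `p` from `u` to `v` uses an arc of the split digraph between the out copy of
`u` and the in copy of `v`. -/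
noncomputable def arcCount {G : SimpleGraph V} {u v : V} (p : G.Walk u v) :
    V × Bool → V × Bool → ℕ
  -- The walk starts at the out copy of `u` and ends at the in copy of `v`, so the start is dropped
  -- by `tail` and `v` is set to 0.
  | (x, false), (y, true) => if x = y then (if x = v then 0 else p.support.tail.count x) else 0
  | (x, true), (y, false) => (p.darts.map fun d => d.toProd).count (x, y)
  | (_, false), (_, false) => 0
  | (_, true), (_, true) => 0

variable [Fintype V]

theorem sum_count_fst [DecidableEq V] (l : List (V × V)) (x : V) :
    ∑ y, l.count (x, y) = (l.map Prod.fst).count x := by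
  induction l with
  | nil => simp
  | cons a l ih =>
    obtain ⟨a, b⟩ := a
    simp only [List.count_cons, Finset.sum_add_distrib, ih, List.map_cons, beq_iff_eq,
      Prod.mk.injEq]
    by_cases h : a = x <;> simp [h]

theorem sum_count_snd [DecidableEq V] (l : List (V × V)) (y : V) :
    ∑ x, l.count (x, y) = (l.map Prod.snd).count y := by
  induction l with
  | nil => simp
  | cons a l ih =>
    obtain ⟨a, b⟩ := a
    simp only [List.count_cons, Finset.sum_add_distrib, ih, List.map_cons, beq_iff_eq,
      Prod.mk.injEq]
    by_cases h : b = y <;> simp [h]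

section
open Classical

variable {G : SimpleGraph V} {u v : V}

theorem sum_arcCount_in (p : G.Walk u v) (x : V) :
    ∑ y, arcCount p (x, false) y = if x = v then 0 else p.support.tail.count x := by
  simp [Fintype.sum_prod_type, arcCount]

theorem sum_arcCount_out (p : G.Walk u v) (x : V) :
    ∑ y, arcCount p (x, true) y = p.support.dropLast.count x := by
  simp only [Fintype.sum_prod_type, Fintype.sum_bool, arcCount, zero_add, sum_count_fst,
    List.map_map]
  rw [← p.map_fst_darts]
  rfl

theorem sum_arcCount_to_in (p : G.Walk u v) (x : V) :
    ∑ y, arcCount p y (x, false) = p.support.tail.count x := by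
  simp only [Fintype.sum_prod_type, Fintype.sum_bool, arcCount, add_zero, sum_count_snd,
    List.map_map]
  rw [← p.map_snd_darts]
  rfl

theorem sum_arcCount_to_out (p : G.Walk u v) (x : V) :
    ∑ y, arcCount p y (x, true) = if x = v then 0 else p.support.tail.count x := by
  simp [Fintype.sum_prod_type, arcCount]

end

end Flow

/-! ### Flows from families of paths, and cuts from faulty sets -/

section FlowOfPaths

variable {V : Type*} {G : SimpleGraph V} {u v : V}

open Classical in
theorem count_dropLast {p : G.Walk u v} (hp : p.IsPath) (x : V) :
    p.support.dropLast.count x = if x = v then 0 else p.support.count x := by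
  have h := congrArg (List.count x) p.dropLast_support_concat
  rw [List.count_append, List.count_singleton] at h
  by_cases hx : x = v
  · subst hx
    have := List.nodup_iff_count_le_one.1 hp.support_nodup x
    rw [if_pos (beq_self_eq_true x)] at h
    rw [if_pos rfl]
    omega
  · rw [if_neg hx]
    simpa [Ne.symm hx] using h

open Classical in
theorem count_tail (p : G.Walk u v) (x : V) :
    p.support.count x = p.support.tail.count x + if x = u then 1 else 0 := by
  conv_lhs => rw [← p.cons_tail_support, List.count_cons]
  simp only [beq_iff_eq, eq_comm (a := x)]

theorem arcCount_le_one {p : G.Walk u v} (hp : p.IsPath) (a b : V × Bool) :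
    arcCount p a b ≤ 1 := by
  classical
  have h1 : ∀ x, p.support.count x ≤ 1 := List.nodup_iff_count_le_one.1 hp.support_nodup
  obtain ⟨x, _ | _⟩ := a <;> obtain ⟨y, _ | _⟩ := b <;> simp only [arcCount, zero_le]
  · split_ifs
    · exact zero_le_one
    · exact (List.Sublist.count_le x (List.tail_sublist _)).trans (h1 x)
    · exact zero_le_one
  · refine List.count_le_count_map (f := Prod.fst) |>.trans ?_
    rw [List.map_map]
    change (p.darts.map fun d => d.fst).count x ≤ 1
    rw [p.map_fst_darts]
    exact (List.Sublist.count_le x (List.dropLast_sublist _)).trans (h1 x)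

/-- Two paths using the same arc share its tail, which is not `v`; this is what the capacity check
relies on. -/
theorem eq_of_arcCount_ne_zero {p : G.Walk u v} (hp : p.IsPath) {a b : V × Bool}
    (h : arcCount p a b ≠ 0) : a.1 ∈ p.support ∧ a.1 ≠ v ∧
      ((a.1 = b.1 ∧ a.2 = false ∧ b.2 = true ∧ a.1 ≠ u) ∨
        (G.Adj a.1 b.1 ∧ a.2 = true ∧ b.2 = false)) := by
  classical
  obtain ⟨x, _ | _⟩ := a <;> obtain ⟨y, _ | _⟩ := b <;> simp only [arcCount] at h
  · exact absurd rfl h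
  · split_ifs at h with hxy hxv
    · exact absurd rfl h
    · have hmem := List.count_pos_iff.1 (Nat.pos_of_ne_zero h)
      refine ⟨List.mem_of_mem_tail hmem, hxv, Or.inl ⟨hxy, rfl, rfl, ?_⟩⟩
      rintro (rfl : x = u)
      have := hp.support_nodup
      rw [← p.cons_tail_support] at this
      exact (List.nodup_cons.1 this).1 hmem
    · exact absurd rfl h
  · obtain ⟨d, hd, hdxy⟩ := List.mem_map.1 (List.count_pos_iff.1 (Nat.pos_of_ne_zero h))
    obtain ⟨rfl, rfl⟩ := Prod.ext_iff.1 hdxy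
    refine ⟨p.dart_fst_mem_support_of_mem_darts hd, ?_, Or.inr ⟨d.adj, rfl, rfl⟩⟩
    intro hv
    have h0 := count_dropLast hp d.fst
    rw [if_pos hv, ← p.map_fst_darts] at h0
    exact List.count_eq_zero.1 h0 (List.mem_map_of_mem hd)
  · exact absurd rfl h

/-- The source side holds both copies of each vertex of `C` and the in copies of faulty vertices.
Since `C` is closed, only in-to-out arcs of faulty vertices cross, and these have capacity 1 because
faulty vertices are untrusted. -/
theorem splitCap_cut_le {T B C : Finset V} (k : ℕ) (hBT : Disjoint B T)
    (hC : ∀ x ∈ C, ∀ y ∉ B, G.Adj x y → y ∈ C) {a b : V × Bool}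
    (ha : a.1 ∈ C ∨ (a.1 ∈ B ∧ a.2 = false)) (hb : ¬ (b.1 ∈ C ∨ (b.1 ∈ B ∧ b.2 = false))) :
    splitCap G T k u a b ≤ 1 ∧ (splitCap G T k u a b ≠ 0 → a.1 ∈ B ∧ a.2 = false ∧
      b = (a.1, true)) := by
  obtain ⟨x, _ | _⟩ := a <;> obtain ⟨y, _ | _⟩ := b <;> simp only [splitCap] at ha hb ⊢
  · exact ⟨Nat.zero_le _, fun h => absurd rfl h⟩
  · by_cases hxy : x = y
    · subst hxy
      have hxC : x ∉ C := fun h => hb (Or.inl h)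
      have hxB : x ∈ B := (ha.resolve_left hxC).1
      simp [hxB, Finset.disjoint_left.1 hBT hxB]
    · simp [hxy]
  · have hxC : x ∈ C := by simpa using ha
    have hadj : ¬ G.Adj x y := fun h => by
      by_cases hy : y ∈ B
      · exact hb (Or.inr ⟨hy, trivial⟩)
      · exact hb (Or.inl (hC x hxC y hy h))
    simp [hadj]
  · exact ⟨Nat.zero_le _, fun h => absurd rfl h⟩

variable [Fintype V]

theorem sum_arcCount_conserve {p : G.Walk u v} (hp : p.IsPath) {a : V × Bool}
    (ha : a ≠ (u, true)) (ha' : a ≠ (v, false)) :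
    ∑ b, arcCount p a b = ∑ b, arcCount p b a := by
  classical
  obtain ⟨x, _ | _⟩ := a
  · have hx : x ≠ v := fun h => ha' (h ▸ rfl)
    rw [sum_arcCount_in, sum_arcCount_to_in, if_neg hx]
  · have hx : x ≠ u := fun h => ha (h ▸ rfl)
    rw [sum_arcCount_out, sum_arcCount_to_out, count_dropLast hp, count_tail p, if_neg hx, add_zero]

theorem sum_arcCount_source {p : G.Walk u v} (hp : p.IsPath) (huv : u ≠ v) :
    ∑ b, arcCount p (u, true) b = 1 ∧ ∑ b, arcCount p b (u, true) = 0 := by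
  classical
  have h1 : p.support.count u ≤ 1 := List.nodup_iff_count_le_one.1 hp.support_nodup u
  have h2 := count_tail p u
  rw [if_pos rfl] at h2
  rw [sum_arcCount_out, sum_arcCount_to_out, count_dropLast hp, if_neg huv, if_neg huv]
  omega

/-- Bounds the set of flow values, as needed to compare a flow with the `sSup` in `maxFlow`. -/
theorem sum_source_le (c : V × Bool → V × Bool → ℕ) {s t : V × Bool} {r : ℝ}
    (hr : r ∈ {r | ∃ φ, IsFlow c s t φ ∧ r = ∑ y, φ s y - ∑ y, φ y s}) :
    r ≤ ∑ y, (c s y : ℝ) := by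
  obtain ⟨φ, hφ, rfl⟩ := hr
  have h1 : ∑ y, φ s y ≤ ∑ y, (c s y : ℝ) := Finset.sum_le_sum fun y _ => hφ.le_cap s y
  have h2 : 0 ≤ ∑ y, φ y s := Finset.sum_nonneg fun y _ => hφ.nonneg y s
  linarith

/-- `k` paths that share only trusted vertices and their ends carry a flow of value `k`. -/
theorem le_maxFlow_of_paths {T : Finset V} (huv : u ≠ v) {ι : Type*} [Fintype ι] {k : ℕ}
    (hk : Fintype.card ι = k) (p : ι → G.Path u v)
    (hp : ∀ i j, i ≠ j → ∀ w, w ∈ (p i).1.support → w ∈ (p j).1.support →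
      w ∈ T ∨ w = u ∨ w = v) :
    (k : ℝ) ≤ maxFlow (splitCap G T k u) (u, true) (v, false) := by
  classical
  refine le_csSup ⟨_, fun r hr => sum_source_le _ hr⟩
    ⟨fun a b => ((∑ i, arcCount (p i).1 a b : ℕ) : ℝ), ⟨?_, ?_, ?_⟩, ?_⟩
  · exact fun _ _ => Nat.cast_nonneg _
  · intro a b
    rw [Nat.cast_le]
    have hle : ∀ i, arcCount (p i).1 a b ≤ 1 := fun i => arcCount_le_one (p i).2 a b
    have hsumk : ∑ i, arcCount (p i).1 a b ≤ k := by
      have := Finset.sum_le_card_nsmul Finset.univ _ 1 fun i _ => hle i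
      simpa [hk] using this
    by_cases h0 : ∑ i, arcCount (p i).1 a b = 0
    · rw [h0]
      exact Nat.zero_le _
    obtain ⟨i, -, hi⟩ := Finset.exists_ne_zero_of_sum_ne_zero h0
    -- Two paths using an arc would share its tail, which must then be trusted or `u`. The remaining
    -- arcs have capacity `k`, and `hsumk` suffices.
    have hsum1 : a.1 ∉ T → a.1 ≠ u → ∑ i, arcCount (p i).1 a b ≤ 1 := by
      intro haT hau
      rw [Finset.sum_eq_single i]
      · exact hle i
      · intro j _ hji
        by_contra hj
        have h1 := eq_of_arcCount_ne_zero (p i).2 hi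
        have h2 := eq_of_arcCount_ne_zero (p j).2 hj
        rcases hp j i hji a.1 h2.1 h1.1 with h | h | h
        · exact haT h
        · exact hau h
        · exact h1.2.1 h
      · exact fun h => absurd (Finset.mem_univ i) h
    have hi' := eq_of_arcCount_ne_zero (p i).2 hi
    obtain ⟨x, _ | _⟩ := a <;> obtain ⟨y, _ | _⟩ := b <;> simp only [splitCap] at hi' ⊢
    · simp at hi'
    · obtain ⟨-, -, ⟨rfl, -, -, hxu⟩ | h⟩ := hi'
      · rw [if_pos rfl]
        split_ifs with hT
        · exact hsumk
        · exact hsum1 hT hxu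
      · simp at h
    · obtain ⟨-, -, h | ⟨h, -⟩⟩ := hi'
      · simp at h
      · rw [if_pos h]
        split_ifs with hT
        · exact hsumk
        · exact hsum1 (fun h => hT (Or.inl h)) fun h => hT (Or.inr h)
    · simp at hi'
  · intro a ha ha'
    simp only [← Nat.cast_sum]
    rw [Finset.sum_comm, Finset.sum_comm (s := Finset.univ (α := V × Bool))]
    exact congrArg _ (Finset.sum_congr rfl fun i _ => sum_arcCount_conserve (p i).2 ha ha')
  · simp only [← Nat.cast_sum]
    rw [Finset.sum_comm, Finset.sum_comm (s := Finset.univ (α := V × Bool))]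
    rw [Finset.sum_congr rfl fun i _ => (sum_arcCount_source (p i).2 huv).1,
      Finset.sum_congr rfl fun i _ => (sum_arcCount_source (p i).2 huv).2]
    simp [hk]

/-- Expanding an edge of the contracted graph adds trusted vertices only. The expanded paths may
coincide, so they are kept as an indexed family; its size is exactly `f + 1`, matching the
capacities. -/
theorem le_maxFlow_of_le_kappa {T : Finset V} (huv : u ≠ v) {f : ℕ}
    (h : ((f + 1 : ℕ) : ℕ∞) ≤ kappa (insertedGraph G T u v) u v) :
    ((f + 1 : ℕ) : ℝ) ≤ maxFlow (splitCap G T (f + 1) u) (u, true) (v, false) := by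
  obtain ⟨P, hP, hk⟩ := le_kappa_iff.1 h
  obtain ⟨Q, hQ, hQk⟩ := Finset.exists_subset_card_eq hk
  have hpath : ∀ p : (insertedGraph G T u v).Path u v, ∃ q : G.Path u v,
      ∀ x ∈ q.1.support, x ∈ {x | x ∈ p.1.support ∨ x ∈ T} := by
    intro p
    have h1 := reachIn_of_walk (X := {x | x ∈ p.1.support}) p.1 fun x hx => hx
    exact ReachIn.exists_path (Or.inl p.1.start_mem_support)
      (h1.of_insertedGraph (fun x => Or.inl) fun x => Or.inr)
  choose q hq using hpath
  refine le_maxFlow_of_paths huv (ι := Q) (by simpa using hQk) (fun i => q i) ?_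
  intro i j hij w hi hj
  rcases hq i w hi with h1 | h1
  · rcases hq j w hj with h2 | h2
    · exact Or.inr (hP i (hQ i.2) j (hQ j.2) (fun h => hij (Subtype.ext h)) w h1 h2)
    · exact Or.inl h2
  · exact Or.inl h1

/-- The value of a flow is at most the capacity of a cut. -/
theorem IsFlow.value_le_cut {W : Type*} [Fintype W] [DecidableEq W] {c : W → W → ℕ} {s t : W}
    {φ : W → W → ℝ} (hφ : IsFlow c s t φ) (S : Finset W) (hs : s ∈ S) (ht : t ∉ S) :
    ∑ y, φ s y - ∑ y, φ y s ≤ ∑ x ∈ S, ∑ y ∈ Sᶜ, (c x y : ℝ) := by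
  have h1 : ∑ x ∈ S, (∑ y, φ x y - ∑ y, φ y x) = ∑ y, φ s y - ∑ y, φ y s :=
    Finset.sum_eq_single_of_mem s hs fun x hx hxs =>
      sub_eq_zero.2 (hφ.conserve x hxs fun h => ht (h ▸ hx))
  have h2 : ∀ x, ∑ y, φ x y - ∑ y, φ y x = (∑ y ∈ S, φ x y - ∑ y ∈ S, φ y x) +
      (∑ y ∈ Sᶜ, φ x y - ∑ y ∈ Sᶜ, φ y x) := by
    intro x
    rw [← Finset.sum_add_sum_compl S, ← Finset.sum_add_sum_compl S fun y => φ y x]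
    ring
  have h3 : ∑ x ∈ S, (∑ y ∈ S, φ x y - ∑ y ∈ S, φ y x) = 0 := by
    rw [Finset.sum_sub_distrib, Finset.sum_comm, sub_self]
  rw [← h1, Finset.sum_congr rfl fun x _ => h2 x, Finset.sum_add_distrib, h3, zero_add]
  refine Finset.sum_le_sum fun x _ => ?_
  have h4 : ∑ y ∈ Sᶜ, φ x y ≤ ∑ y ∈ Sᶜ, (c x y : ℝ) :=
    Finset.sum_le_sum fun y _ => hφ.le_cap x y
  have h5 : 0 ≤ ∑ y ∈ Sᶜ, φ y x := Finset.sum_nonneg fun y _ => hφ.nonneg y x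
  linarith

open Classical in
theorem sum_splitCap_cut_le {T B C : Finset V} (k : ℕ) (hBT : Disjoint B T)
    (hC : ∀ x ∈ C, ∀ y ∉ B, G.Adj x y → y ∈ C) (S : Finset (V × Bool))
    (hS : ∀ a, a ∈ S ↔ a.1 ∈ C ∨ (a.1 ∈ B ∧ a.2 = false)) :
    ∑ a ∈ S, ∑ b ∈ Sᶜ, splitCap G T k u a b ≤ B.card := by
  have hcut : ∀ ab ∈ S ×ˢ Sᶜ, splitCap G T k u ab.1 ab.2 ≤ 1 ∧
      (splitCap G T k u ab.1 ab.2 ≠ 0 → ab.1.1 ∈ B ∧ ab.1.2 = false ∧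
        ab.2 = (ab.1.1, true)) := by
    intro ab hab
    obtain ⟨ha, hb⟩ := Finset.mem_product.1 hab
    exact splitCap_cut_le k hBT hC ((hS _).1 ha) fun h => Finset.mem_compl.1 hb ((hS _).2 h)
  rw [← Finset.sum_product', ← Finset.sum_filter_ne_zero]
  refine (Finset.sum_le_card_nsmul _ _ 1 fun ab hab =>
    (hcut ab (Finset.mem_filter.1 hab).1).1).trans ?_
  rw [smul_eq_mul, mul_one]
  -- An arc of the cut with nonzero capacity is determined by its faulty vertex.
  refine Finset.card_le_card_of_injOn (fun ab => ab.1.1) (fun ab hab => ?_) ?_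
  · obtain ⟨h1, h2⟩ := Finset.mem_filter.1 hab
    exact ((hcut ab h1).2 h2).1
  · intro ab hab cd hcd h
    obtain ⟨h1, h2⟩ := Finset.mem_filter.1 hab
    obtain ⟨h3, h4⟩ := Finset.mem_filter.1 hcd
    obtain ⟨-, h5, h6⟩ := (hcut ab h1).2 h2
    obtain ⟨-, h7, h8⟩ := (hcut cd h3).2 h4
    have h9 : ab.1 = cd.1 := Prod.ext h (h5.trans h7.symm)
    exact Prod.ext h9 (by rw [h6, h8, h9])

/-- If `B` cut `u` off from `v`, the vertices reachable from `u` would give a cut of capacity at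
most `B.card ≤ f`; weak duality suffices. -/
theorem reachIn_of_le_maxFlow {T B : Finset V} {f k : ℕ}
    (h : ((f + 1 : ℕ) : ℝ) ≤ maxFlow (splitCap G T k u) (u, true) (v, false))
    (hB : Faulty T f B) (hv : v ∉ B) : ReachIn G {x | x ∉ B} u v := by
  classical
  by_contra hno
  let C : Finset V := Finset.univ.filter fun x => ReachIn G {x | x ∉ B} u x
  let S : Finset (V × Bool) := Finset.univ.filter fun a => a.1 ∈ C ∨ (a.1 ∈ B ∧ a.2 = false)
  have hcut : ∑ a ∈ S, ∑ b ∈ Sᶜ, splitCap G T k u a b ≤ B.card := by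
    refine sum_splitCap_cut_le k hB.1 (C := C) ?_ S (by simp [S])
    intro x hx y hy hxy
    simp only [C, Finset.mem_filter, Finset.mem_univ, true_and] at hx ⊢
    exact hx.tail ⟨hxy, hy⟩
  have hle : maxFlow (splitCap G T k u) (u, true) (v, false) ≤ f := by
    -- The zero flow shows that the set of flow values is nonempty.
    refine csSup_le ⟨0, fun _ _ => 0, ⟨by simp, by simp, by simp⟩, by simp⟩ ?_
    rintro r ⟨φ, hφ, rfl⟩
    have hu : ReachIn G {x | x ∉ B} u u := Relation.ReflTransGen.refl
    refine (hφ.value_le_cut S (by simp [S, C, hu])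
      (by simp [S, C, hno, hv])).trans ?_
    exact_mod_cast hcut.trans hB.2
  push_cast at h
  linarith

end FlowOfPaths

/-! ### The two verification conditions -/

section Verification

/-- Paths need not be reversed one by one: the equivalent separation condition is visibly symmetric.
-/
theorem adj_or_le_kappa_comm {V : Type*} [Fintype V] {f : ℕ} {H : SimpleGraph V} {u v : V} (huv : u ≠ v) :
    H.Adj u v ∨ ((f + 1 : ℕ) : ℕ∞) ≤ kappa H u v ↔
      H.Adj v u ∨ ((f + 1 : ℕ) : ℕ∞) ≤ kappa H v u := by
  rw [← reachIn_iff_adj_or_le_kappa huv, ← reachIn_iff_adj_or_le_kappa huv.symm]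
  exact ⟨fun h S hv hu hS => (h S hu hv hS).symm hu, fun h S hu hv hS => (h S hv hu hS).symm hv⟩

variable {V : Type*} [LinearOrder V] {G : SimpleGraph V} {T : Finset V} {f : ℕ}

theorem forall_reachIn_iff :
    (∀ B, Faulty T f B → ∀ s ∉ B, ∀ q ∉ B, ReachIn G {x | x ∉ B} s q) ↔
      ∀ u v, u < v → ∀ B, Faulty T f B → u ∉ B → v ∉ B → ReachIn G {x | x ∉ B} u v := by
  constructor
  · exact fun h u v _ B hB hu hv => h B hB u hu v hv
  · intro h B hB s hs q hq
    rcases lt_trichotomy s q with hsq | rfl | hsq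
    · exact h s q hsq B hB hs hq
    · exact .refl
    · exact (h q s hsq B hB hq hs).symm hq

theorem connectivityVerif_iff [Fintype V] : ConnectivityVerif G T (f + 1) ↔ ∀ u v, u < v →
    (insertedGraph G T u v).Adj u v ∨
      ((f + 1 : ℕ) : ℕ∞) ≤ kappa (insertedGraph G T u v) u v := by
  have h1 : ∀ u v, u ∉ T → v ∉ T → ((((f + 1 : ℕ) : ℕ∞) ≤
      kappa (untrustedGraph G T).spanningCoe u v ∨ (untrustedGraph G T).Adj v u) ↔
      ((insertedGraph G T u v).Adj u v ∨
        ((f + 1 : ℕ) : ℕ∞) ≤ kappa (insertedGraph G T u v) u v)) := by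
    intro u v hu hv
    rw [← untrustedGraph_spanningCoe hu hv, SimpleGraph.Subgraph.spanningCoe_adj,
      SimpleGraph.Subgraph.adj_comm, or_comm]
  have h2 : ∀ u v, v ∉ T → ((((f + 1 : ℕ) : ℕ∞) ≤
      kappa (addNode G T (untrustedGraph G T) u).spanningCoe u v ∨
        (addNode G T (untrustedGraph G T) u).Adj v u) ↔
      ((insertedGraph G T u v).Adj u v ∨
        ((f + 1 : ℕ) : ℕ∞) ≤ kappa (insertedGraph G T u v) u v)) := by
    intro u v hv
    rw [← addNode_spanningCoe hv, SimpleGraph.Subgraph.spanningCoe_adj,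
      SimpleGraph.Subgraph.adj_comm, or_comm]
  have h3 : ∀ u v, ((((f + 1 : ℕ) : ℕ∞) ≤
      kappa (addNode G T (addNode G T (untrustedGraph G T) u) v).spanningCoe u v ∨
        (addNode G T (addNode G T (untrustedGraph G T) u) v).Adj v u) ↔
      ((insertedGraph G T u v).Adj u v ∨
        ((f + 1 : ℕ) : ℕ∞) ≤ kappa (insertedGraph G T u v) u v)) := by
    intro u v
    rw [← addNode_addNode_spanningCoe, SimpleGraph.Subgraph.spanningCoe_adj,
      SimpleGraph.Subgraph.adj_comm, or_comm]
  constructor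
  · rintro ⟨huu, htu, htt⟩ u v huv
    by_cases hu : u ∈ T <;> by_cases hv : v ∈ T
    · exact (h3 u v).1 (htt u v hu hv huv)
    · exact (h2 u v hv).1 (htu u v hu hv)
    -- The mixed clause always lists the trusted vertex first, whatever the order, so the pair is
    -- swapped.
    · rw [adj_or_le_kappa_comm huv.ne, insertedGraph_comm]
      exact (h2 v u hu).1 (htu v u hv hu)
    · exact (h1 u v hu hv).1 (huu u v hu hv huv)
  · refine fun h => ⟨fun u v hu hv huv => (h1 u v hu hv).2 (h u v huv), fun u v hu hv => ?_,
      fun u v _ _ huv => (h3 u v).2 (h u v huv)⟩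
    rw [h2 u v hv]
    rcases lt_trichotomy u v with huv | rfl | huv
    · exact h u v huv
    · exact absurd hu hv
    · rw [adj_or_le_kappa_comm huv.ne', insertedGraph_comm]
      exact h v u huv

theorem maxFlowVerif_iff [Fintype V] {k : ℕ} : MaxFlowVerif G T k ↔ ∀ u v, u < v →
    (insertedGraph G T u v).Adj u v ∨
      (k : ℝ) ≤ maxFlow (splitCap G T k u) (u, true) (v, false) := by
  have hadj : ∀ u v : V, ((u ∉ T ∧ v ∉ T ∧ (untrustedGraph G T).Adj u v) ∨
     (u ∈ T ∧ v ∉ T ∧ (addNode G T (untrustedGraph G T) u).Adj u v) ∨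
     (u ∉ T ∧ v ∈ T ∧ (addNode G T (untrustedGraph G T) v).Adj v u) ∨
     (u ∈ T ∧ v ∈ T ∧ (addNode G T (addNode G T (untrustedGraph G T) u) v).Adj v u)) ↔
     (insertedGraph G T u v).Adj u v := by
    intro u v
    by_cases hu : u ∈ T <;> by_cases hv : v ∈ T <;>
      simp only [hu, hv, not_true_eq_false, not_false_eq_true, false_and, true_and, or_false,
        false_or]
    · rw [← addNode_addNode_spanningCoe, SimpleGraph.Subgraph.spanningCoe_adj,
        SimpleGraph.Subgraph.adj_comm]
    · rw [← addNode_spanningCoe hv, SimpleGraph.Subgraph.spanningCoe_adj]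
    · rw [insertedGraph_comm, ← addNode_spanningCoe hu, SimpleGraph.Subgraph.spanningCoe_adj,
        SimpleGraph.Subgraph.adj_comm]
    · rw [← untrustedGraph_spanningCoe hu hv, SimpleGraph.Subgraph.spanningCoe_adj]
  simp only [MaxFlowVerif, hadj]

theorem reachIn_iff_connectivityVerif [Fintype V] :
    (∀ B, Faulty T f B → ∀ s ∉ B, ∀ q ∉ B, ReachIn G {x | x ∉ B} s q) ↔
      ConnectivityVerif G T (f + 1) := by
  rw [forall_reachIn_iff, connectivityVerif_iff]
  refine forall₃_congr fun u v huv => ?_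
  rw [forall_faulty_reachIn_iff, reachIn_iff_adj_or_le_kappa huv.ne]

/-- Reachability gives disjoint paths and these give a flow; a flow gives reachability directly, so
no disjoint paths are extracted from it. -/
theorem reachIn_iff_maxFlowVerif [Fintype V] :
    (∀ B, Faulty T f B → ∀ s ∉ B, ∀ q ∉ B, ReachIn G {x | x ∉ B} s q) ↔
      MaxFlowVerif G T (f + 1) := by
  rw [forall_reachIn_iff, maxFlowVerif_iff]
  refine forall₃_congr fun u v huv => ⟨fun h => ?_, ?_⟩
  · rw [forall_faulty_reachIn_iff, reachIn_iff_adj_or_le_kappa huv.ne] at h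
    exact h.imp id (le_maxFlow_of_le_kappa huv.ne)
  · rintro (h | h)
    · exact forall_faulty_reachIn_iff.2 ((reachIn_iff_adj_or_le_kappa huv.ne).2 (Or.inl h))
    · exact fun B hB _ hv => reachIn_of_le_maxFlow h hB hv

end Verification

/-! ### Networks without trusted processes -/

section Untrusted

variable {V : Type*} {G : SimpleGraph V} {f : ℕ}

theorem induce_preconnected_iff {B : Finset V} : (G.induce {v | v ∉ B}).Preconnected ↔
    ∀ s ∉ B, ∀ q ∉ B, ReachIn G {x | x ∉ B} s q := by
  constructor
  · intro h s hs q hq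
    obtain ⟨p⟩ := h ⟨s, hs⟩ ⟨q, hq⟩
    have hwalk : ∀ (a b : ({v | v ∉ B} : Set V)), (G.induce {v | v ∉ B}).Walk a b →
        ReachIn G {x | x ∉ B} a b := by
      intro a b p
      induction p with
      | nil => exact .refl
      | @cons a c b hac _ ih => exact Relation.ReflTransGen.head ⟨hac, c.2⟩ ih
    exact hwalk _ _ p
  · rintro h ⟨s, hs⟩ ⟨q, hq⟩
    obtain ⟨p, hp⟩ := (h s hs q hq).exists_walk hs
    exact ⟨p.induce _ hp⟩

variable [Fintype V]

theorem reachIn_iff_vertexConnected (hf : f + 2 ≤ Fintype.card V) :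
    (∀ B, Faulty ∅ f B → ∀ s ∉ B, ∀ q ∉ B, ReachIn G {x | x ∉ B} s q) ↔
      VertexConnected G (f + 1) := by
  constructor
  · refine fun h => ⟨hf, fun S hS => ?_⟩
    have hS' : S.card ≤ f := Nat.lt_succ_iff.1 hS
    -- `Connected` includes nonemptiness, so a vertex outside `S` is needed.
    obtain ⟨x, hx⟩ : ∃ x, x ∉ S := by
      by_contra! hall
      have := Finset.card_eq_iff_eq_univ S |>.2 (Finset.eq_univ_iff_forall.2 hall)
      omega
    have : Nonempty ({v | v ∉ S} : Set V) := ⟨⟨x, hx⟩⟩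
    exact ⟨induce_preconnected_iff.2 (h S ⟨Finset.disjoint_empty_right S, hS'⟩)⟩
  · exact fun h B hB => induce_preconnected_iff.1 (h.2 B (Nat.lt_succ_iff.2 hB.2)).preconnected

/-- With at most `f + 1` vertices, all processes except two may be faulty, which forces these two to
be adjacent; larger complete graphs are covered by `VertexConnected`. -/
theorem reachIn_iff_complete_or_vertexConnected :
    (∀ B, Faulty ∅ f B → ∀ s ∉ B, ∀ q ∉ B, ReachIn G {x | x ∉ B} s q) ↔
      G = ⊤ ∨ VertexConnected G (f + 1) := by
  classical
  by_cases hf : f + 2 ≤ Fintype.card V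
  · rw [reachIn_iff_vertexConnected hf]
    refine ⟨Or.inr, ?_⟩
    rintro (rfl | h)
    · refine (reachIn_iff_vertexConnected hf).1 fun B _ s _ q hq => ?_
      by_cases hsq : s = q
      · exact hsq ▸ .refl
      · exact Relation.ReflTransGen.single ⟨hsq, hq⟩
    · exact h
  · constructor
    · refine fun h => Or.inl ?_
      rw [SimpleGraph.eq_top_iff_forall_ne_adj]
      intro u v huv
      have hcard := Finset.card_pair huv
      have hB : Faulty ∅ f ({u, v} : Finset V)ᶜ := by
        refine ⟨Finset.disjoint_empty_right _, ?_⟩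
        rw [Finset.card_compl]
        omega
      by_contra hadj
      have hinv : ∀ w, ReachIn G {x | x ∉ ({u, v} : Finset V)ᶜ} u w → w = u := by
        intro w hw
        induction hw with
        | refl => rfl
        | @tail x y _ hxy ih =>
          subst ih
          have hy : y = x ∨ y = v := by simpa [or_iff_not_imp_left] using hxy.2
          rcases hy with rfl | rfl
          · rfl
          · exact absurd hxy.1 hadj
      exact huv (hinv v (h _ hB u (by simp) v (by simp))).symm
    · rintro (rfl | h)
      · intro B _ s _ q hq
        by_cases hsq : s = q
        · exact hsq ▸ .refl
        · exact Relation.ReflTransGen.single ⟨hsq, hq⟩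
      · exact absurd h.1 hf

end Untrusted

end SigFloodT

theorem mainTheorem6 {V : Type*} [Fintype V] [LinearOrder V] {M : Type*} [Nonempty M]
    (G : SimpleGraph V) (T : Finset V) (f : ℕ) :
    SigFloodT.RCNoDuplication M G T f ∧
    SigFloodT.RCNoCreation M G T f ∧
    (SigFloodT.RCValidity M G T f ↔ SigFloodT.ConnectivityVerif G T (f + 1)) ∧
    (SigFloodT.RCValidity M G T f ↔ SigFloodT.MaxFlowVerif G T (f + 1)) ∧
    (T = ∅ →
      (SigFloodT.RCValidity M G T f ↔ G = ⊤ ∨ SigFloodT.VertexConnected G (f + 1))) ∧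
    (T = ∅ → f + 2 ≤ Fintype.card V →
      (SigFloodT.RCValidity M G T f ↔ SigFloodT.VertexConnected G (f + 1))) := by
  rw [SigFloodT.rcValidity_iff_reachIn]
  refine ⟨SigFloodT.rcNoDuplication M G T f, SigFloodT.rcNoCreation M G T f,
    SigFloodT.reachIn_iff_connectivityVerif, SigFloodT.reachIn_iff_maxFlowVerif, ?_, ?_⟩
  · rintro rfl
    exact SigFloodT.reachIn_iff_complete_or_vertexConnected
  · rintro rfl hf
    exact SigFloodT.reachIn_iff_vertexConnected hf
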